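/- Let $W_1,\dots,W_D$ be independent one-dimensional Brownian motions with respect to a filtration $(\mathcal F_t)_{t\ge 0}$ on a probability space, let $Y_0$ be an $\mathcal F_0$-measurable $\mathbb R^m$-valued random variable with $E|Y_0|^2<\infty$, and let $T>0$. Consider the Stratonovich equation $dY=f(Y)\,dt+\sum_{r=1}^D g_r(Y)\circ dW_r$ on $[0,T]$, $Y(0)=Y_0$, with $f,g_r:\mathbb R^m\to\mathbb R^m$, and let the $C^1$ map $L:\mathbb R^m\to\mathbb R^\nu$ be an invariant of it, i.e. $\nabla L\,f=0$ and $\nabla L\,g_r=0$ on $\mathbb R^m$ for $r=1,\dots,D$, where $\nabla L$ is the Jacobian matrix. Let $C_b^k$ denote the $k$ times continuously differentiable functions that are bounded together with all their derivatives of order at most $k$. Let $(c_i,b_i)_{i=1}^M$ be a quadrature formula of order $q\ge 2$, i.e. $\sum_{i} b_ic_i^k=\int_0^1x^k\,dx$ for $k=0,\dots,q-1$. Assume that $f,g_1,\dots,g_D,\nabla L\in C_b^{q+1}$, that $\nabla L(y)\nabla L(y)^\top$ is invertible for every $y\in\mathbb R^m$, and that $[\nabla L\nabla L^\top]^{-1}\in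 C_b^1$. For $N\ge 1$ put $h=T/N$, $t_n=nh$, and let $\Delta\widehat W_{r,n}=\sqrt h\,\zeta_{r,n}$, where $\zeta_{r,n}$ is $\xi_{r,n}=(W_r(t_{n+1})-W_r(t_n))/\sqrt h$ truncated to the interval $[-A_h,A_h]$, $A_h=\sqrt{4|\ln h|}$ (so $\zeta_{r,n}=\max(-A_h,\min(\xi_{r,n},A_h))$). The MAVF method with quadrature consists of random vectors $y_0=Y_0,y_1,\dots,y_N$, with $y_n$ being $\mathcal F_{t_n}$-measurable, and $\mathcal F_{t_{n+1}}$-measurable $\mathbb R^\nu$-valued modification coefficients $\alpha_{r,n}$ ($0\le r\le D$, $0\le n<N$) such that, almost surely for every $0\le n<N$, with $\sigma_n(\tau)=y_n+\tau(y_{n+1}-y_n)$, $A_n=\sum_i b_i\nabla L(\sigma_n(c_i))$, $F_n=\sum_i b_i f(\sigma_n(c_i))$ and $G_{r,n}=\sum_i b_i g_r(\sigma_n(c_i))$, $$y_{n+1}=y_n+h\,[F_n-A_n^\top\alpha_{0,n}]+\sum_{r=1}^D\Delta\widehat W_{r,n}\,[G_{r,n}-A_n^\top\alpha_{r,n}],$$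 $$A_nA_n^\top\alpha_{0,n}=A_nF_n,\qquad A_nA_n^\top\alpha_{r,n}=A_nG_{r,n}\quad(r=1,\dots,D).$$ Then there are $h_0>0$ and $K$, independent of $N$, such that for every $N\ge1$ with $h=T/N\le h_0$ such a discretization exists, and every such discretization satisfies $E|L(y_N)-L(y_0)|^2<\infty$ and $$\left[E|L(y_N)-L(y_0)|^2\right]^{1/2}\le\begin{cases}K\,h^{q/2},& q \text{ even},\\ K\,h^{(q-1)/2},& q\text{ odd}.\end{cases}$$ -/

import Mathlib

open MeasureTheory ProbabilityTheory
open scoped NNReal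

noncomputable section

namespace MAVF

/-- `φ` is of class `C_b^k`: it is `k` times continuously differentiable and `φ` together with all
its derivatives of order at most `k` is bounded. -/
def CbSmooth {V G : Type*} [NormedAddCommGroup V] [NormedSpace ℝ V]
    [NormedAddCommGroup G] [NormedSpace ℝ G] (k : ℕ) (φ : V → G) : Prop :=
  ContDiff ℝ k φ ∧ ∀ j ≤ k, ∃ C : ℝ, ∀ x, ‖iteratedFDeriv ℝ j φ x‖ ≤ C

variable {m ν D M : ℕ}

/-- The (vector valued) `C^1` function `L` is an invariant of the Stratonovich equation
`dY = f(Y) dt + ∑ r, g_r(Y) ∘ dW_r`: `∇L f = 0` and `∇L g_r = 0` at every point, where the Jacobian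
`∇L(x)` is the linear map `fderiv ℝ L x`. -/
def IsInvariant (f : EuclideanSpace ℝ (Fin m) → EuclideanSpace ℝ (Fin m))
    (g : Fin D → EuclideanSpace ℝ (Fin m) → EuclideanSpace ℝ (Fin m))
    (L : EuclideanSpace ℝ (Fin m) → EuclideanSpace ℝ (Fin ν)) : Prop :=
  ContDiff ℝ 1 L ∧ ∀ x, fderiv ℝ L x (f x) = 0 ∧ ∀ r, fderiv ℝ L x (g r x) = 0

/-- The Gram operator `∇L(x) ∇L(x)ᵀ`. -/
def gram (L : EuclideanSpace ℝ (Fin m) → EuclideanSpace ℝ (Fin ν)) (x : EuclideanSpace ℝ (Fin m)) :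
    EuclideanSpace ℝ (Fin ν) →L[ℝ] EuclideanSpace ℝ (Fin ν) :=
  (fderiv ℝ L x).comp (ContinuousLinearMap.adjoint (fderiv ℝ L x))

/-- The quadrature formula `∫₀¹ φ ≈ ∑ i, b i * φ (c i)` has order `q`: it is exact for polynomials
of degree at most `q - 1`. -/
def HasQuadratureOrder (b c : Fin M → ℝ) (q : ℕ) : Prop :=
  ∀ k < q, ∑ i, b i * c i ^ k = ∫ x in (0 : ℝ)..1, x ^ k

/-- The quadrature sum `∑ i, b i φ(σ(c i))` along the segment `σ(τ) = y + τ (y' - y)`. -/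
def quadSum {V : Type*} [AddCommGroup V] [Module ℝ V] (b c : Fin M → ℝ)
    (φ : EuclideanSpace ℝ (Fin m) → V) (y y' : EuclideanSpace ℝ (Fin m)) : V :=
  ∑ i, b i • φ (y + c i • (y' - y))

/-- One step `y ↦ y'` of the modified averaged vector field method with quadrature, with step size
`h`, noise increments `w r`, and modification coefficients `α₀`, `α r`. -/
def IsStep (b c : Fin M → ℝ) (f : EuclideanSpace ℝ (Fin m) → EuclideanSpace ℝ (Fin m))
    (g : Fin D → EuclideanSpace ℝ (Fin m) → EuclideanSpace ℝ (Fin m))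
    (L : EuclideanSpace ℝ (Fin m) → EuclideanSpace ℝ (Fin ν))
    (h : ℝ) (w : Fin D → ℝ) (y y' : EuclideanSpace ℝ (Fin m))
    (α₀ : EuclideanSpace ℝ (Fin ν)) (α : Fin D → EuclideanSpace ℝ (Fin ν)) : Prop :=
  let A := quadSum b c (fderiv ℝ L) y y'
  let At := ContinuousLinearMap.adjoint A
  y' = y + h • (quadSum b c f y y' - At α₀) + ∑ r, w r • (quadSum b c (g r) y y' - At (α r)) ∧
    A (At α₀) = A (quadSum b c f y y') ∧
    ∀ r, A (At (α r)) = A (quadSum b c (g r) y y')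

/-- The truncated Brownian increment `√h ζ` built from an increment `w` over a step of length `h`:
`ζ` is `ξ = w / √h` truncated to `[-A, A]`, where `A = √(4 |log h|)`. -/
def truncIncr (h w : ℝ) : ℝ :=
  √h * max (-√(4 * |Real.log h|)) (min (w / √h) √(4 * |Real.log h|))

/-- The grid point `t_n = n h` with step size `h = T / N`. -/
def gridTime (T : ℝ≥0) (N n : ℕ) : ℝ≥0 := n * (T / N)

variable {Ω : Type*} {mΩ : MeasurableSpace Ω}

/-- `W_1, …, W_D` are independent one-dimensional Brownian motions with respect to the
filtration `𝓕`. -/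
structure IsBrownianFamily (𝓕 : Filtration ℝ≥0 mΩ) (W : Fin D → ℝ≥0 → Ω → ℝ)
    (P : Measure Ω) : Prop where
  brownian : ∀ r, IsBrownianReal (W r) P
  indep : iIndepFun (fun r ω t ↦ W r t ω) P
  adapted : ∀ r, Adapted 𝓕 (W r)
  indep_past : ∀ s t, s ≤ t →
    Indep (MeasurableSpace.comap (fun ω r ↦ W r t ω - W r s ω) inferInstance) (𝓕 s) P

/-- `y_0, …, y_N`, with modification coefficients `α₀ n`, `α n r` at the `n`-th step, is a
numerical discretization on `[0, T]` with step size `T / N` generated by the modified averaged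
vector field method with quadrature, started at `Y₀`. -/
structure IsDiscretization (𝓕 : Filtration ℝ≥0 mΩ) (P : Measure Ω) (W : Fin D → ℝ≥0 → Ω → ℝ)
    (b c : Fin M → ℝ) (f : EuclideanSpace ℝ (Fin m) → EuclideanSpace ℝ (Fin m))
    (g : Fin D → EuclideanSpace ℝ (Fin m) → EuclideanSpace ℝ (Fin m))
    (L : EuclideanSpace ℝ (Fin m) → EuclideanSpace ℝ (Fin ν))
    (Y₀ : Ω → EuclideanSpace ℝ (Fin m)) (T : ℝ≥0) (N : ℕ)
    (y : ℕ → Ω → EuclideanSpace ℝ (Fin m)) (α₀ : ℕ → Ω → EuclideanSpace ℝ (Fin ν))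
    (α : ℕ → Fin D → Ω → EuclideanSpace ℝ (Fin ν)) : Prop where
  init : y 0 = Y₀
  measurable_y : ∀ n ≤ N, Measurable[𝓕 (gridTime T N n)] (y n)
  measurable_α₀ : ∀ n < N, Measurable[𝓕 (gridTime T N (n + 1))] (α₀ n)
  measurable_α : ∀ n < N, ∀ r, Measurable[𝓕 (gridTime T N (n + 1))] (α n r)
  step : ∀ n < N, ∀ᵐ ω ∂P, IsStep b c f g L (T / N)
    (fun r ↦ truncIncr (T / N) (W r (gridTime T N (n + 1)) ω - W r (gridTime T N n) ω))
    (y n ω) (y (n + 1) ω) (α₀ n ω) (fun r ↦ α n r ω)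

end MAVF

end

/-!
A solution `α` of `A A† α = A u` makes `u - A† α` the orthogonal projection of `u` onto `ker A`,
even if `A A†` is singular. Hence every step of the method has length at most a constant times
`h + ∑ |w_r|` (`IsStep.norm_displacement_le`), and the averaged Jacobian annihilates the
displacement `Δ = y' - y` (`IsStep.quadSum_fderiv_sub_eq_zero`). The increment `L y' - L y` is
therefore the error of the quadrature formula for `τ ↦ ∇L(y + τ Δ) Δ`. Taylor's formula and the
order `q` of the quadrature reduce it to a multiple of `D^{q+1} L(y) (Δ, …, Δ)`, up to a remainder
of order `q + 2` (`norm_sub_quadSum_fderiv_le`). Since `∇L g_r = 0`, the displacement is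
`∑ w_r g_r(y)` to first order (`IsStep.norm_sub_sum_noise_le`). This gives the local expansion
`exists_norm_sub_leadTerm_le`: in terms of the size `√h + ∑ |w_r|` of the data, the increment of `L`
is a leading term `Ξ(y, w)`, homogeneous of degree `q + 1` in the noise, up to order `q + 2`.

In mean square the size of the data is of order `√h` (`IsBrownianFamily.integral_size_pow_le`).
Over `N = T / h` steps the remainders, each of order `h^{(q+2)/2}` in `L²`, sum up to order
`h^{q/2}`. The leading terms are of order `h^{(q+1)/2}`, and the triangle inequality gives
`h^{(q-1)/2}` for their sum. For even `q` they are odd in the noise, whose law is symmetric and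
which is independent of the past; they are thus orthogonal to the past
(`IsDiscretization.integral_inner_leadTerm_eq_zero`), their mean squares add up, and their sum is of
order `h^{q/2}` as well.

A solution of the implicit equation exists because the truncated noise is uniformly small for small
`h`: the step map is then a contraction of a ball around `y` (`exists_fixedPoint_stepMap`), and its
fixed point, a limit of iterates, depends measurably on `y` and the noise
(`exists_measurable_step`).
-/

namespace MAVF

/-! ### Orthogonal projection onto the kernel of an operator -/

open ContinuousLinearMap

section Projection

variable {E F : Type*} [NormedAddCommGroup E] [InnerProductSpace ℝ E] [CompleteSpace E]
  [NormedAddCommGroup F] [InnerProductSpace ℝ F] [CompleteSpace F]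

/-- A solution `α` of the normal equation makes `u - A† α` the orthogonal projection of `u` onto
`ker A`, whether or not `A A†` is invertible. -/
lemma norm_sub_adjoint_le (A : E →L[ℝ] F) {α : F} {u : E} (h : A (adjoint A α) = A u) :
    ‖u - adjoint A α‖ ≤ ‖u‖ := by
  have h0 : inner ℝ (u - adjoint A α) (adjoint A α) = 0 := by
    rw [adjoint_inner_right, map_sub, h, sub_self, inner_zero_left]
  have h1 := norm_add_sq_eq_norm_sq_add_norm_sq_real h0
  rw [sub_add_cancel] at h1
  nlinarith [norm_nonneg u, norm_nonneg (u - adjoint A α), norm_nonneg (adjoint A α)]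

/-- Bounds `‖α‖ ≤ c ‖B† α‖` persist, with twice the constant, near `B`. -/
lemma norm_le_adjoint_of_near {A B : E →L[ℝ] F} {c : ℝ} (hc : 0 ≤ c)
    (hB : ∀ α, ‖α‖ ≤ c * ‖adjoint B α‖) (hAB : c * ‖A - B‖ ≤ 1 / 2) (α : F) :
    ‖α‖ ≤ 2 * c * ‖adjoint A α‖ := by
  have h1 : ‖adjoint B α‖ ≤ ‖adjoint A α‖ + ‖A - B‖ * ‖α‖ := by
    have h2 : adjoint B α = adjoint A α - adjoint (A - B) α := by simp
    have h3 : ‖adjoint (A - B) α‖ ≤ ‖A - B‖ * ‖α‖ := by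
      rw [← LinearIsometryEquiv.norm_map adjoint (A - B)]
      exact le_opNorm _ _
    rw [h2]
    exact (norm_sub_le _ _).trans (by gcongr)
  have h4 := mul_le_mul_of_nonneg_left h1 hc
  have h5 := mul_le_mul_of_nonneg_right hAB (norm_nonneg α)
  nlinarith [hB α]

/-- The correction `A† α` is controlled by `A u`: it is small when `u` is almost in `ker A`. -/
lemma norm_adjoint_le_of_normal_eq {A : E →L[ℝ] F} {c : ℝ}
    (hA : ∀ α, ‖α‖ ≤ c * ‖adjoint A α‖) {α : F} {u : E} (h : A (adjoint A α) = A u) :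
    ‖adjoint A α‖ ≤ c * ‖A u‖ := by
  have h1 : ‖adjoint A α‖ ^ 2 ≤ ‖α‖ * ‖A u‖ := by
    rw [← real_inner_self_eq_norm_sq, adjoint_inner_left, h]
    exact real_inner_le_norm _ _
  have h2 := mul_le_mul_of_nonneg_right (hA α) (norm_nonneg (A u))
  rcases (norm_nonneg (adjoint A α)).eq_or_lt with h0 | h0
  · have := hA α
    rw [← h0, mul_zero] at this
    have hα : α = 0 := norm_le_zero_iff.1 this
    rw [← h, hα]; simp
  · nlinarith

lemma norm_le_gram_of_norm_le_adjoint {A : E →L[ℝ] F} {c : ℝ}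
    (hA : ∀ α, ‖α‖ ≤ c * ‖adjoint A α‖) (α : F) :
    ‖α‖ ≤ c ^ 2 * ‖(A.comp (adjoint A)) α‖ := by
  have h1 : ‖adjoint A α‖ ^ 2 ≤ ‖α‖ * ‖(A.comp (adjoint A)) α‖ := by
    rw [← real_inner_self_eq_norm_sq, adjoint_inner_left]
    exact real_inner_le_norm _ _
  rcases (norm_nonneg α).eq_or_lt with h0 | h0
  · rw [← h0]; positivity
  · have h2 : ‖α‖ ^ 2 ≤ (c * ‖adjoint A α‖) ^ 2 := pow_le_pow_left₀ h0.le (hA α) 2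
    have h3 : ‖α‖ ^ 2 ≤ c ^ 2 * (‖α‖ * ‖(A.comp (adjoint A)) α‖) := by
      rw [mul_pow] at h2
      exact h2.trans (by gcongr)
    nlinarith

variable [FiniteDimensional ℝ F]

lemma isUnit_gram {A : E →L[ℝ] F} {c : ℝ} (hA : ∀ α, ‖α‖ ≤ c * ‖adjoint A α‖) :
    IsUnit (A.comp (adjoint A)) := by
  have hinj : Function.Injective (A.comp (adjoint A)) := by
    rw [injective_iff_map_eq_zero]
    intro α hα
    have := norm_le_gram_of_norm_le_adjoint hA α
    rw [hα, norm_zero, mul_zero] at this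
    exact norm_le_zero_iff.1 this
  have hbij : Function.Bijective (A.comp (adjoint A)) :=
    ⟨hinj, LinearMap.surjective_of_injective (f := (A.comp (adjoint A)).toLinearMap) hinj⟩
  rwa [ContinuousLinearMap.isUnit_iff_bijective]

lemma norm_inverse_gram_le {A : E →L[ℝ] F} {c : ℝ} (hA : ∀ α, ‖α‖ ≤ c * ‖adjoint A α‖) :
    ‖Ring.inverse (A.comp (adjoint A))‖ ≤ c ^ 2 := by
  refine ContinuousLinearMap.opNorm_le_bound _ (sq_nonneg c) fun β ↦ ?_
  have h := norm_le_gram_of_norm_le_adjoint hA (Ring.inverse (A.comp (adjoint A)) β)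
  rwa [← mul_apply_eq_comp, Ring.mul_inverse_cancel _ (isUnit_gram hA),
    one_apply_eq_self] at h

/-- The coefficient `(A A†)⁻¹ A u` solving the normal equation `A A† α = A u`, when `A A†` is
invertible. -/
noncomputable def normalCoeff (A : E →L[ℝ] F) (u : E) : F :=
  Ring.inverse (A.comp (adjoint A)) (A u)

lemma normalCoeff_spec {A : E →L[ℝ] F} {c : ℝ} (hA : ∀ α, ‖α‖ ≤ c * ‖adjoint A α‖) (u : E) :
    A (adjoint A (normalCoeff A u)) = A u := by
  change (A.comp (adjoint A) * Ring.inverse (A.comp (adjoint A))) (A u) = A u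
  rw [Ring.mul_inverse_cancel _ (isUnit_gram hA), one_apply_eq_self]

/-- The orthogonal projection of `u` onto `ker A` depends Lipschitz continuously on `A` and `u`. -/
lemma norm_proj_sub_proj_le {A B : E →L[ℝ] F} {c a : ℝ} (hA : ∀ α, ‖α‖ ≤ c * ‖adjoint A α‖)
    (hB : ∀ α, ‖α‖ ≤ c * ‖adjoint B α‖) (hAa : ‖A‖ ≤ a) (hBa : ‖B‖ ≤ a) (u v : E) :
    ‖(u - adjoint A (normalCoeff A u)) - (v - adjoint B (normalCoeff B v))‖ ≤
      ‖u - v‖ + (2 * a * c ^ 2 + 2 * a ^ 3 * c ^ 4) * ‖A - B‖ * ‖u‖ := by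
  set X := Ring.inverse (A.comp (adjoint A)) with hX
  set Y := Ring.inverse (B.comp (adjoint B)) with hY
  have ha : 0 ≤ a := (norm_nonneg A).trans hAa
  have hXn : ‖X‖ ≤ c ^ 2 := norm_inverse_gram_le hA
  have hYn : ‖Y‖ ≤ c ^ 2 := norm_inverse_gram_le hB
  have hAadj : ‖adjoint A‖ ≤ a := by simpa using hAa
  have hBadj : ‖adjoint B‖ ≤ a := by simpa using hBa
  have hAB : ‖adjoint A - adjoint B‖ = ‖A - B‖ := by rw [← map_sub, LinearIsometryEquiv.norm_map]
  have hgram : ‖A.comp (adjoint A) - B.comp (adjoint B)‖ ≤ 2 * a * ‖A - B‖ := by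
    have : A.comp (adjoint A) - B.comp (adjoint B) =
        (A - B).comp (adjoint A) + B.comp (adjoint A - adjoint B) := by
      ext; simp
    rw [this]
    refine (norm_add_le _ _).trans ?_
    have h1 := opNorm_comp_le (A - B) (adjoint A)
    have h2 := opNorm_comp_le B (adjoint A - adjoint B)
    rw [hAB] at h2
    have h3 : ‖A - B‖ * ‖adjoint A‖ ≤ ‖A - B‖ * a := by gcongr
    have h4 : ‖B‖ * ‖A - B‖ ≤ a * ‖A - B‖ := by gcongr
    linarith
  have hXY : ‖X - Y‖ ≤ c ^ 4 * (2 * a * ‖A - B‖) := by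
    have : X - Y = Y * (B.comp (adjoint B) - A.comp (adjoint A)) * X := by
      rw [mul_sub, sub_mul, mul_assoc Y (A.comp (adjoint A)) X, hX, hY,
        Ring.mul_inverse_cancel _ (isUnit_gram hA), Ring.inverse_mul_cancel _ (isUnit_gram hB),
        one_mul, mul_one]
    rw [this]
    calc _ ≤ ‖Y‖ * ‖B.comp (adjoint B) - A.comp (adjoint A)‖ * ‖X‖ :=
          (norm_mul_le _ _).trans (by gcongr; exact norm_mul_le _ _)
      _ ≤ c ^ 2 * (2 * a * ‖A - B‖) * c ^ 2 := by
          rw [norm_sub_rev]; gcongr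
      _ = _ := by ring
  -- the projection onto `ker B` is a contraction; the rest is the change of the projection
  have key : (u - adjoint A (normalCoeff A u)) - (v - adjoint B (normalCoeff B v)) =
      ((u - v) - adjoint B (normalCoeff B (u - v))) -
        ((adjoint A - adjoint B) (X (A u)) + adjoint B ((X - Y) (A u)) +
          adjoint B (Y ((A - B) u))) := by
    simp only [normalCoeff, ← hX, ← hY, map_sub, sub_apply]
    abel
  rw [key]
  have hAu : ‖A u‖ ≤ a * ‖u‖ := (A.le_opNorm u).trans (by gcongr)
  have t1 : ‖(adjoint A - adjoint B) (X (A u))‖ ≤ ‖A - B‖ * (c ^ 2 * (a * ‖u‖)) := by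
    refine (le_opNorm _ _).trans ?_
    rw [hAB]
    gcongr
    exact (X.le_opNorm _).trans (by gcongr)
  have t2 : ‖adjoint B ((X - Y) (A u))‖ ≤ a * (c ^ 4 * (2 * a * ‖A - B‖) * (a * ‖u‖)) := by
    refine (le_opNorm _ _).trans ?_
    gcongr
    exact ((X - Y).le_opNorm _).trans (by gcongr)
  have t3 : ‖adjoint B (Y ((A - B) u))‖ ≤ a * (c ^ 2 * (‖A - B‖ * ‖u‖)) := by
    refine (le_opNorm _ _).trans ?_
    gcongr
    refine (Y.le_opNorm _).trans ?_
    gcongr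
    exact (A - B).le_opNorm u
  have t0 := norm_sub_adjoint_le B (normalCoeff_spec hB (u - v))
  refine (norm_sub_le _ _).trans ?_
  have t4 := norm_add₃_le (a := (adjoint A - adjoint B) (X (A u)))
    (b := adjoint B ((X - Y) (A u))) (c := adjoint B (Y ((A - B) u)))
  calc _ ≤ ‖u - v‖ + (‖A - B‖ * (c ^ 2 * (a * ‖u‖)) +
          a * (c ^ 4 * (2 * a * ‖A - B‖) * (a * ‖u‖)) + a * (c ^ 2 * (‖A - B‖ * ‖u‖))) := by
        linarith
    _ = _ := by ring

end Projection

/-! ### Quadrature sums -/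

section Quadrature

variable {m M : ℕ} {V : Type*} [NormedAddCommGroup V] [NormedSpace ℝ V]

lemma norm_quadSum_le (b c : Fin M → ℝ) {φ : EuclideanSpace ℝ (Fin m) → V} {C : ℝ}
    (hφ : ∀ x, ‖φ x‖ ≤ C) (y y' : EuclideanSpace ℝ (Fin m)) :
    ‖quadSum b c φ y y'‖ ≤ (∑ i, |b i|) * C := by
  rw [quadSum, Finset.sum_mul]
  refine norm_sum_le_of_le _ fun i _ ↦ ?_
  rw [norm_smul, Real.norm_eq_abs]
  gcongr
  exact hφ _

lemma norm_quadSum_sub_le (b c : Fin M → ℝ) {φ : EuclideanSpace ℝ (Fin m) → V} {C : ℝ}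
    (hφ : ∀ x x', ‖φ x - φ x'‖ ≤ C * ‖x - x'‖) (y z z' : EuclideanSpace ℝ (Fin m)) :
    ‖quadSum b c φ y z - quadSum b c φ y z'‖ ≤ (∑ i, |b i| * |c i|) * C * ‖z - z'‖ := by
  rw [quadSum, quadSum, ← Finset.sum_sub_distrib, Finset.sum_mul, Finset.sum_mul]
  refine norm_sum_le_of_le _ fun i _ ↦ ?_
  rw [← smul_sub, norm_smul, Real.norm_eq_abs]
  have h := hφ (y + c i • (z - y)) (y + c i • (z' - y))
  have h1 : (y + c i • (z - y)) - (y + c i • (z' - y)) = c i • (z - z') := by module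
  rw [h1, norm_smul, Real.norm_eq_abs] at h
  calc _ ≤ |b i| * (C * (|c i| * ‖z - z'‖)) := by gcongr
    _ = _ := by ring

lemma quadSum_self {b : Fin M → ℝ} (hb : ∑ i, b i = 1) (c : Fin M → ℝ)
    (φ : EuclideanSpace ℝ (Fin m) → V) (y : EuclideanSpace ℝ (Fin m)) :
    quadSum b c φ y y = φ y := by
  simp [quadSum, ← Finset.sum_smul, hb]

end Quadrature

/-! ### Bounds for a single step -/

open ContinuousLinearMap

section Bounds

variable {m ν D M : ℕ}

/-- The quantitative hypotheses on the coefficients that enter the analysis of a single step, with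
one common constant `C`. The last field is the uniform lower bound for `∇Lᵀ` which the bounded
inverse of the Gram operator provides. -/
structure StepBounds (b c : Fin M → ℝ) (f : EuclideanSpace ℝ (Fin m) → EuclideanSpace ℝ (Fin m))
    (g : Fin D → EuclideanSpace ℝ (Fin m) → EuclideanSpace ℝ (Fin m))
    (L : EuclideanSpace ℝ (Fin m) → EuclideanSpace ℝ (Fin ν)) (C : ℝ) : Prop where
  one_le : 1 ≤ C
  sum_weights : ∑ i, b i = 1
  sum_abs_weights_le : ∑ i, |b i| ≤ C
  sum_abs_mul_le : ∑ i, |b i| * |c i| ≤ C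
  norm_drift_le : ∀ x, ‖f x‖ ≤ C
  lip_drift : ∀ x x', ‖f x - f x'‖ ≤ C * ‖x - x'‖
  norm_noise_le : ∀ r x, ‖g r x‖ ≤ C
  lip_noise : ∀ r x x', ‖g r x - g r x'‖ ≤ C * ‖x - x'‖
  norm_fderiv_le : ∀ x, ‖fderiv ℝ L x‖ ≤ C
  lip_fderiv : ∀ x x', ‖fderiv ℝ L x - fderiv ℝ L x'‖ ≤ C * ‖x - x'‖
  le_adjoint : ∀ x α, ‖α‖ ≤ C * ‖adjoint (fderiv ℝ L x) α‖

lemma CbSmooth.exists_bound_lip {V G : Type*} [NormedAddCommGroup V] [NormedSpace ℝ V]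
    [NormedAddCommGroup G] [NormedSpace ℝ G] {k : ℕ} (hk : 1 ≤ k) {φ : V → G}
    (hφ : CbSmooth k φ) :
    ∃ C : ℝ, (∀ x, ‖φ x‖ ≤ C) ∧ ∀ x x', ‖φ x - φ x'‖ ≤ C * ‖x - x'‖ := by
  obtain ⟨C₀, h₀⟩ := hφ.2 0 (Nat.zero_le _)
  obtain ⟨C₁, h₁⟩ := hφ.2 1 hk
  simp only [norm_iteratedFDeriv_zero, norm_iteratedFDeriv_one] at h₀ h₁
  refine ⟨max C₀ C₁, fun x ↦ (h₀ x).trans (le_max_left _ _), fun x x' ↦ ?_⟩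
  have hd : Differentiable ℝ φ :=
    hφ.1.differentiable (by simpa using Nat.one_le_iff_ne_zero.1 hk)
  have := convex_univ.norm_image_sub_le_of_norm_fderiv_le (f := φ) (𝕜 := ℝ) (C := C₁)
    (fun x _ ↦ hd x) (fun x _ ↦ h₁ x) (Set.mem_univ x') (Set.mem_univ x)
  exact this.trans (by gcongr; exact le_max_right _ _)

/-- A bounded inverse of the Gram operator bounds `∇Lᵀ` from below, since `α` is recovered from
`∇Lᵀ α` as `(∇L ∇Lᵀ)⁻¹ ∇L ∇Lᵀ α`. -/
lemma norm_le_adjoint_of_gram {L : EuclideanSpace ℝ (Fin m) → EuclideanSpace ℝ (Fin ν)}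
    {x : EuclideanSpace ℝ (Fin m)} (hx : IsUnit (gram L x)) {C C' : ℝ}
    (hC : ‖fderiv ℝ L x‖ ≤ C) (hC' : ‖Ring.inverse (gram L x)‖ ≤ C')
    (α : EuclideanSpace ℝ (Fin ν)) : ‖α‖ ≤ C' * C * ‖adjoint (fderiv ℝ L x) α‖ := by
  have h : α = Ring.inverse (gram L x) (fderiv ℝ L x (adjoint (fderiv ℝ L x) α)) := by
    change α = (Ring.inverse (gram L x) * gram L x) α
    rw [Ring.inverse_mul_cancel _ hx, one_apply_eq_self]
  have hC0 : 0 ≤ C' := (norm_nonneg _).trans hC'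
  calc ‖α‖ = _ := congrArg _ h
    _ ≤ C' * (C * ‖adjoint (fderiv ℝ L x) α‖) := by
        refine (le_opNorm _ _).trans ?_
        gcongr
        exact (le_opNorm _ _).trans (by gcongr)
    _ = _ := by ring

lemma HasQuadratureOrder.sum_mul_pow {b c : Fin M → ℝ} {q k : ℕ} (h : HasQuadratureOrder b c q)
    (hk : k < q) : ∑ i, b i * c i ^ k = ((k : ℝ) + 1)⁻¹ := by
  rw [h k hk]; simp

lemma exists_stepBounds {f : EuclideanSpace ℝ (Fin m) → EuclideanSpace ℝ (Fin m)}
    {g : Fin D → EuclideanSpace ℝ (Fin m) → EuclideanSpace ℝ (Fin m)}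
    {L : EuclideanSpace ℝ (Fin m) → EuclideanSpace ℝ (Fin ν)}
    {b c : Fin M → ℝ} {q : ℕ} (hq : 0 < q) (hbc : HasQuadratureOrder b c q)
    {k : ℕ} (hk : 1 ≤ k) (hf : CbSmooth k f) (hg : ∀ r, CbSmooth k (g r))
    (hDL : CbSmooth k (fderiv ℝ L)) (hinv : ∀ x, IsUnit (gram L x))
    (hinvb : ∃ C, ∀ x, ‖Ring.inverse (gram L x)‖ ≤ C) :
    ∃ C, StepBounds b c f g L C := by
  obtain ⟨Cf, hf₀, hf₁⟩ := hf.exists_bound_lip hk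
  choose Cg hg₀ hg₁ using fun r ↦ (hg r).exists_bound_lip hk
  obtain ⟨Cl, hl₀, hl₁⟩ := hDL.exists_bound_lip hk
  obtain ⟨Ci, hi⟩ := hinvb
  have hgs (r) : Cg r ≤ ∑ s, |Cg s| := (le_abs_self _).trans
    (Finset.single_le_sum (f := fun s ↦ |Cg s|) (fun s _ ↦ abs_nonneg _) (Finset.mem_univ r))
  have p1 := abs_nonneg Cf
  have p2 : 0 ≤ ∑ s, |Cg s| := Finset.sum_nonneg fun _ _ ↦ abs_nonneg _
  have p3 := abs_nonneg Cl
  have p4 := abs_nonneg (Ci * Cl)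
  have p5 : 0 ≤ ∑ i, |b i| := Finset.sum_nonneg fun _ _ ↦ abs_nonneg _
  have p6 : 0 ≤ ∑ i, |b i| * |c i| := Finset.sum_nonneg fun _ _ ↦ by positivity
  set C := 1 + |Cf| + (∑ s, |Cg s|) + |Cl| + |Ci * Cl| + (∑ i, |b i|) + ∑ i, |b i| * |c i| with hC
  have e1 : Cf ≤ C := by linarith [le_abs_self Cf]
  have e2 (r) : Cg r ≤ C := by linarith [hgs r]
  have e3 : Cl ≤ C := by linarith [le_abs_self Cl]
  have e4 : Ci * Cl ≤ C := by linarith [le_abs_self (Ci * Cl)]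
  refine ⟨C, by linarith, ?_, by linarith, by linarith, fun x ↦ (hf₀ x).trans e1,
    fun x x' ↦ (hf₁ x x').trans (by gcongr), fun r x ↦ (hg₀ r x).trans (e2 r),
    fun r x x' ↦ (hg₁ r x x').trans (mul_le_mul_of_nonneg_right (e2 r) (norm_nonneg _)),
    fun x ↦ (hl₀ x).trans e3,
    fun x x' ↦ (hl₁ x x').trans (by gcongr), fun x α ↦ ?_⟩
  · simpa using hbc.sum_mul_pow hq
  · exact (norm_le_adjoint_of_gram (hinv x) (hl₀ x) (hi x) α).trans (by gcongr)

variable {f : EuclideanSpace ℝ (Fin m) → EuclideanSpace ℝ (Fin m)}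
    {g : Fin D → EuclideanSpace ℝ (Fin m) → EuclideanSpace ℝ (Fin m)}
    {L : EuclideanSpace ℝ (Fin m) → EuclideanSpace ℝ (Fin ν)}
    {b c : Fin M → ℝ} {C : ℝ}

lemma StepBounds.nonneg (hB : StepBounds b c f g L C) : 0 ≤ C := zero_le_one.trans hB.one_le

lemma StepBounds.norm_quadSum_drift_le (hB : StepBounds b c f g L C)
    (y y' : EuclideanSpace ℝ (Fin m)) : ‖quadSum b c f y y'‖ ≤ C ^ 2 := by
  have := hB.nonneg
  refine (norm_quadSum_le b c hB.norm_drift_le y y').trans ?_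
  rw [sq]; gcongr; exact hB.sum_abs_weights_le

lemma StepBounds.norm_quadSum_noise_le (hB : StepBounds b c f g L C) (r : Fin D)
    (y y' : EuclideanSpace ℝ (Fin m)) : ‖quadSum b c (g r) y y'‖ ≤ C ^ 2 := by
  have := hB.nonneg
  refine (norm_quadSum_le b c (hB.norm_noise_le r) y y').trans ?_
  rw [sq]; gcongr; exact hB.sum_abs_weights_le

lemma StepBounds.norm_quadSum_fderiv_le (hB : StepBounds b c f g L C)
    (y y' : EuclideanSpace ℝ (Fin m)) : ‖quadSum b c (fderiv ℝ L) y y'‖ ≤ C ^ 2 := by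
  have := hB.nonneg
  refine (norm_quadSum_le b c hB.norm_fderiv_le y y').trans ?_
  rw [sq]; gcongr; exact hB.sum_abs_weights_le

lemma StepBounds.norm_quadSum_drift_sub_le (hB : StepBounds b c f g L C)
    (y z z' : EuclideanSpace ℝ (Fin m)) :
    ‖quadSum b c f y z - quadSum b c f y z'‖ ≤ C ^ 2 * ‖z - z'‖ := by
  have := hB.nonneg
  refine (norm_quadSum_sub_le b c hB.lip_drift y z z').trans ?_
  rw [sq]; gcongr; exact hB.sum_abs_mul_le

lemma StepBounds.norm_quadSum_noise_sub_le (hB : StepBounds b c f g L C) (r : Fin D)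
    (y z z' : EuclideanSpace ℝ (Fin m)) :
    ‖quadSum b c (g r) y z - quadSum b c (g r) y z'‖ ≤ C ^ 2 * ‖z - z'‖ := by
  have := hB.nonneg
  refine (norm_quadSum_sub_le b c (hB.lip_noise r) y z z').trans ?_
  rw [sq]; gcongr; exact hB.sum_abs_mul_le

lemma StepBounds.norm_quadSum_fderiv_sub_le (hB : StepBounds b c f g L C)
    (y z z' : EuclideanSpace ℝ (Fin m)) :
    ‖quadSum b c (fderiv ℝ L) y z - quadSum b c (fderiv ℝ L) y z'‖ ≤ C ^ 2 * ‖z - z'‖ := by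
  have := hB.nonneg
  refine (norm_quadSum_sub_le b c hB.lip_fderiv y z z').trans ?_
  rw [sq]; gcongr; exact hB.sum_abs_mul_le

/-- For short steps the averaged Jacobian inherits the lower bound of `∇Lᵀ`. -/
lemma StepBounds.le_adjoint_quadSum (hB : StepBounds b c f g L C)
    {y z : EuclideanSpace ℝ (Fin m)} (hz : C ^ 3 * ‖z - y‖ ≤ 1 / 2)
    (α : EuclideanSpace ℝ (Fin ν)) :
    ‖α‖ ≤ 2 * C * ‖adjoint (quadSum b c (fderiv ℝ L) y z) α‖ := by
  refine norm_le_adjoint_of_near hB.nonneg (hB.le_adjoint y) (le_trans ?_ hz) α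
  have h := hB.norm_quadSum_fderiv_sub_le y z y
  rw [quadSum_self hB.sum_weights] at h
  calc _ ≤ C * (C ^ 2 * ‖z - y‖) := mul_le_mul_of_nonneg_left h hB.nonneg
    _ = _ := by ring

/-- Every step is short: its length is controlled by the step size and the noise alone, since the
modified averages are orthogonal projections of the averages. -/
lemma IsStep.norm_displacement_le (hB : StepBounds b c f g L C) {h : ℝ} {w : Fin D → ℝ}
    {y y' : EuclideanSpace ℝ (Fin m)} {α₀ : EuclideanSpace ℝ (Fin ν)}
    {α : Fin D → EuclideanSpace ℝ (Fin ν)} (hs : IsStep b c f g L h w y y' α₀ α) :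
    ‖y' - y‖ ≤ C ^ 2 * (|h| + ∑ r, |w r|) := by
  obtain ⟨h1, h2, h3⟩ := hs
  have e : y' - y = h • (quadSum b c f y y' - adjoint (quadSum b c (fderiv ℝ L) y y') α₀) +
      ∑ r, w r • (quadSum b c (g r) y y' - adjoint (quadSum b c (fderiv ℝ L) y y') (α r)) := by
    nth_rewrite 1 [h1]; abel
  rw [e, mul_add, Finset.mul_sum]
  refine (norm_add_le _ _).trans (add_le_add ?_ (norm_sum_le_of_le _ fun r _ ↦ ?_))
  · rw [norm_smul, Real.norm_eq_abs, mul_comm]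
    gcongr
    exact (norm_sub_adjoint_le _ h2).trans (hB.norm_quadSum_drift_le y y')
  · rw [norm_smul, Real.norm_eq_abs, mul_comm]
    gcongr
    exact (norm_sub_adjoint_le _ (h3 r)).trans (hB.norm_quadSum_noise_le r y y')

end Bounds

/-! ### Existence of a step -/

section Existence

open Filter Topology

/-- The solution of the normal equation is measurable in parameters, although it is discontinuous
where `A A†` becomes singular: on the open set where `A A†` is invertible it is continuous, and
off this set the inverse has the value `0`. -/
lemma measurable_clm_normalCoeff {Z E F G : Type*} [TopologicalSpace Z] [MeasurableSpace Z]
    [OpensMeasurableSpace Z] [NormedAddCommGroup E] [InnerProductSpace ℝ E] [CompleteSpace E]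
    [NormedAddCommGroup F] [InnerProductSpace ℝ F] [FiniteDimensional ℝ F] [CompleteSpace F]
    [NormedAddCommGroup G] [NormedSpace ℝ G] [MeasurableSpace G] [BorelSpace G]
    {A : Z → E →L[ℝ] F} {u : Z → E} {B : Z → F →L[ℝ] G} (hA : Continuous A) (hu : Continuous u)
    (hB : Continuous B) : Measurable fun z ↦ B z (normalCoeff (A z) (u z)) := by
  classical
  have hgram : Continuous fun z ↦ (A z).comp (adjoint (A z)) :=
    hA.clm_comp ((adjoint (𝕜 := ℝ) (E := E) (F := F)).continuous.comp hA)
  set s : Set Z := {z | IsUnit ((A z).comp (adjoint (A z)))} with hs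
  have hsm : MeasurableSet s := (Units.isOpen.preimage hgram).measurableSet
  have hon : ContinuousOn (fun z ↦ B z (normalCoeff (A z) (u z))) s := by
    refine hB.continuousOn.clm_apply (ContinuousOn.clm_apply ?_ (hA.clm_apply hu).continuousOn)
    intro z hz
    obtain ⟨X, hX⟩ := hz
    have h1 : ContinuousAt Ring.inverse ((A z).comp (adjoint (A z))) :=
      hX ▸ NormedRing.inverse_continuousAt X
    exact (ContinuousAt.comp (f := fun z ↦ (A z).comp (adjoint (A z))) h1
      hgram.continuousAt).continuousWithinAt
  have h := hon.measurable_piecewise (g := fun _ ↦ 0) continuousOn_const hsm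
  convert h using 1
  ext z
  by_cases hz : z ∈ s
  · rw [Set.piecewise_eq_of_mem _ _ _ hz]
  · rw [Set.piecewise_eq_of_notMem _ _ _ hz, normalCoeff, Ring.inverse_non_unit _ hz]
    simp

variable {m ν D M : ℕ} {f : EuclideanSpace ℝ (Fin m) → EuclideanSpace ℝ (Fin m)}
    {g : Fin D → EuclideanSpace ℝ (Fin m) → EuclideanSpace ℝ (Fin m)}
    {L : EuclideanSpace ℝ (Fin m) → EuclideanSpace ℝ (Fin ν)}
    {b c : Fin M → ℝ} {C : ℝ}

/-- The average of `φ` along the segment from `y` to `z`, projected onto the kernel of the averaged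
Jacobian. -/
noncomputable def projQuadSum (b c : Fin M → ℝ)
    (L : EuclideanSpace ℝ (Fin m) → EuclideanSpace ℝ (Fin ν))
    (φ : EuclideanSpace ℝ (Fin m) → EuclideanSpace ℝ (Fin m))
    (y z : EuclideanSpace ℝ (Fin m)) : EuclideanSpace ℝ (Fin m) :=
  quadSum b c φ y z - adjoint (quadSum b c (fderiv ℝ L) y z)
    (normalCoeff (quadSum b c (fderiv ℝ L) y z) (quadSum b c φ y z))

/-- The map whose fixed points `z` are the endpoints of a step from `y`. -/
noncomputable def stepMap (b c : Fin M → ℝ)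
    (f : EuclideanSpace ℝ (Fin m) → EuclideanSpace ℝ (Fin m))
    (g : Fin D → EuclideanSpace ℝ (Fin m) → EuclideanSpace ℝ (Fin m))
    (L : EuclideanSpace ℝ (Fin m) → EuclideanSpace ℝ (Fin ν))
    (h : ℝ) (w : Fin D → ℝ) (y z : EuclideanSpace ℝ (Fin m)) : EuclideanSpace ℝ (Fin m) :=
  y + h • projQuadSum b c L f y z + ∑ r, w r • projQuadSum b c L (g r) y z

lemma continuous_quadSum {V : Type*} [NormedAddCommGroup V] [NormedSpace ℝ V]
    {φ : EuclideanSpace ℝ (Fin m) → V} (hφ : Continuous φ) (b c : Fin M → ℝ) :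
    Continuous fun p : EuclideanSpace ℝ (Fin m) × EuclideanSpace ℝ (Fin m) ↦
      quadSum b c φ p.1 p.2 := by
  unfold quadSum
  fun_prop

lemma measurable_normalCoeff_quadSum
    {φ : EuclideanSpace ℝ (Fin m) → EuclideanSpace ℝ (Fin m)} (hφ : Continuous φ)
    (hL : Continuous (fderiv ℝ L)) (b c : Fin M → ℝ) :
    Measurable fun p : EuclideanSpace ℝ (Fin m) × EuclideanSpace ℝ (Fin m) ↦
      normalCoeff (quadSum b c (fderiv ℝ L) p.1 p.2) (quadSum b c φ p.1 p.2) :=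
  measurable_clm_normalCoeff (B := fun _ ↦ ContinuousLinearMap.id ℝ _)
    (continuous_quadSum hL b c) (continuous_quadSum hφ b c) continuous_const

lemma measurable_projQuadSum
    {φ : EuclideanSpace ℝ (Fin m) → EuclideanSpace ℝ (Fin m)} (hφ : Continuous φ)
    (hL : Continuous (fderiv ℝ L)) (b c : Fin M → ℝ) :
    Measurable fun p : EuclideanSpace ℝ (Fin m) × EuclideanSpace ℝ (Fin m) ↦
      projQuadSum b c L φ p.1 p.2 :=
  (continuous_quadSum hφ b c).measurable.sub (measurable_clm_normalCoeff
    (continuous_quadSum hL b c) (continuous_quadSum hφ b c)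
    ((adjoint (𝕜 := ℝ) (E := EuclideanSpace ℝ (Fin m))
      (F := EuclideanSpace ℝ (Fin ν))).continuous.comp (continuous_quadSum hL b c)))

lemma measurable_stepMap (hf : Continuous f) (hg : ∀ r, Continuous (g r))
    (hL : Continuous (fderiv ℝ L)) (b c : Fin M → ℝ) (h : ℝ) :
    Measurable fun p : (EuclideanSpace ℝ (Fin m) × (Fin D → ℝ)) × EuclideanSpace ℝ (Fin m) ↦
      stepMap b c f g L h p.1.2 p.1.1 p.2 := by
  have hp : Measurable fun p : (EuclideanSpace ℝ (Fin m) × (Fin D → ℝ)) ×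
      EuclideanSpace ℝ (Fin m) ↦ (p.1.1, p.2) := by fun_prop
  have h1 : Measurable fun p : (EuclideanSpace ℝ (Fin m) × (Fin D → ℝ)) ×
      EuclideanSpace ℝ (Fin m) ↦ p.1.1 := by fun_prop
  have h2 (r : Fin D) : Measurable fun p : (EuclideanSpace ℝ (Fin m) × (Fin D → ℝ)) ×
      EuclideanSpace ℝ (Fin m) ↦ p.1.2 r := by fun_prop
  have h3 : Measurable fun p : (EuclideanSpace ℝ (Fin m) × (Fin D → ℝ)) ×
      EuclideanSpace ℝ (Fin m) ↦ projQuadSum b c L f p.1.1 p.2 := by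
    have := (measurable_projQuadSum hf hL b c).comp hp
    exact this
  have h4 (r : Fin D) : Measurable fun p : (EuclideanSpace ℝ (Fin m) × (Fin D → ℝ)) ×
      EuclideanSpace ℝ (Fin m) ↦ projQuadSum b c L (g r) p.1.1 p.2 := by
    have := (measurable_projQuadSum (hg r) hL b c).comp hp
    exact this
  unfold stepMap
  exact (h1.add (h3.const_smul h)).add (Finset.measurable_sum _ fun r _ ↦ (h2 r).smul (h4 r))

lemma norm_projQuadSum_sub_le (hB : StepBounds b c f g L C)
    {φ : EuclideanSpace ℝ (Fin m) → EuclideanSpace ℝ (Fin m)}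
    {y z z' : EuclideanSpace ℝ (Fin m)}
    (hφ₀ : ‖quadSum b c φ y z‖ ≤ C ^ 2)
    (hφ₁ : ‖quadSum b c φ y z - quadSum b c φ y z'‖ ≤ C ^ 2 * ‖z - z'‖)
    (hz : C ^ 3 * ‖z - y‖ ≤ 1 / 2) (hz' : C ^ 3 * ‖z' - y‖ ≤ 1 / 2) :
    ‖projQuadSum b c L φ y z - projQuadSum b c L φ y z'‖ ≤ 41 * C ^ 14 * ‖z - z'‖ := by
  have hC := hB.one_le
  have hC0 := hB.nonneg
  refine (norm_proj_sub_proj_le (hB.le_adjoint_quadSum hz) (hB.le_adjoint_quadSum hz')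
    (hB.norm_quadSum_fderiv_le y z) (hB.norm_quadSum_fderiv_le y z') _ _).trans ?_
  have hA := hB.norm_quadSum_fderiv_sub_le y z z'
  have h2 : C ^ 2 ≤ C ^ 14 := pow_le_pow_right₀ hC (by norm_num)
  have h8 : C ^ 8 ≤ C ^ 14 := pow_le_pow_right₀ hC (by norm_num)
  calc _ ≤ C ^ 2 * ‖z - z'‖ + (2 * C ^ 2 * (2 * C) ^ 2 + 2 * (C ^ 2) ^ 3 * (2 * C) ^ 4) *
          (C ^ 2 * ‖z - z'‖) * C ^ 2 := by gcongr
    _ = (C ^ 2 + 8 * C ^ 8 + 32 * C ^ 14) * ‖z - z'‖ := by ring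
    _ ≤ _ := by gcongr; linarith

lemma norm_projQuadSum_le (hB : StepBounds b c f g L C)
    {φ : EuclideanSpace ℝ (Fin m) → EuclideanSpace ℝ (Fin m)}
    {y z : EuclideanSpace ℝ (Fin m)} (hφ₀ : ‖quadSum b c φ y z‖ ≤ C ^ 2)
    (hz : C ^ 3 * ‖z - y‖ ≤ 1 / 2) :
    ‖projQuadSum b c L φ y z‖ ≤ C ^ 2 :=
  (norm_sub_adjoint_le _ (normalCoeff_spec (hB.le_adjoint_quadSum hz) _)).trans hφ₀

/-- For small data the step map contracts a ball around `y`; its iterates started at `y` converge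
to a fixed point. As `41 * C ^ 14` is a Lipschitz constant of the projected averages, data of size
`(82 * C ^ 14)⁻¹` give the contraction factor `1 / 2`. -/
lemma exists_fixedPoint_stepMap (hB : StepBounds b c f g L C) {h : ℝ} {w : Fin D → ℝ}
    (hw : |h| + ∑ r, |w r| ≤ (82 * C ^ 14)⁻¹) (y : EuclideanSpace ℝ (Fin m)) :
    ∃ z, C ^ 3 * ‖z - y‖ ≤ 1 / 2 ∧ stepMap b c f g L h w y z = z ∧
      Tendsto (fun n ↦ (stepMap b c f g L h w y)^[n] y) atTop (𝓝 z) := by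
  have hC := hB.one_le
  have hC0 : 0 < C := zero_lt_one.trans_le hC
  -- on this ball the averaged Jacobian is close to `∇L(y)`, so its Gram operator is invertible
  set s : Set (EuclideanSpace ℝ (Fin m)) := Metric.closedBall y (2 * C ^ 3)⁻¹ with hs
  have hmem {z} (hz : z ∈ s) : C ^ 3 * ‖z - y‖ ≤ 1 / 2 := by
    rw [hs, Metric.mem_closedBall, dist_eq_norm, ← one_div, le_div_iff₀ (by positivity)] at hz
    linarith
  have hmaps : Set.MapsTo (stepMap b c f g L h w y) s s := by
    intro z hz
    have hz' := hmem hz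
    rw [hs, Metric.mem_closedBall, dist_eq_norm]
    have e : stepMap b c f g L h w y z - y =
        h • projQuadSum b c L f y z + ∑ r, w r • projQuadSum b c L (g r) y z := by
      rw [stepMap]; abel
    have hle : ‖stepMap b c f g L h w y z - y‖ ≤ (|h| + ∑ r, |w r|) * C ^ 2 := by
      rw [e, add_mul, Finset.sum_mul]
      refine (norm_add_le _ _).trans (add_le_add ?_ (norm_sum_le_of_le _ fun r _ ↦ ?_)) <;>
        rw [norm_smul, Real.norm_eq_abs] <;> gcongr
      · exact norm_projQuadSum_le hB (hB.norm_quadSum_drift_le y z) hz'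
      · exact norm_projQuadSum_le hB (hB.norm_quadSum_noise_le r y z) hz'
    have h5 : C ^ 5 ≤ C ^ 14 := pow_le_pow_right₀ hC (by norm_num)
    calc _ ≤ (82 * C ^ 14)⁻¹ * C ^ 2 := hle.trans (by gcongr)
      _ ≤ (2 * C ^ 3)⁻¹ := by
          rw [inv_mul_le_iff₀ (by positivity), ← div_eq_mul_inv, le_div_iff₀ (by positivity)]
          have : 0 < C ^ 14 := by positivity
          linarith [show C ^ 2 * (2 * C ^ 3) = 2 * C ^ 5 by ring]
  have hlip : LipschitzOnWith (1 / 2 : ℝ≥0) (stepMap b c f g L h w y) s := by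
    refine LipschitzOnWith.of_dist_le_mul fun z hz z' hz' ↦ ?_
    rw [dist_eq_norm, dist_eq_norm]
    have e : stepMap b c f g L h w y z - stepMap b c f g L h w y z' =
        h • (projQuadSum b c L f y z - projQuadSum b c L f y z') +
          ∑ r, w r • (projQuadSum b c L (g r) y z - projQuadSum b c L (g r) y z') := by
      simp only [stepMap, smul_sub, Finset.sum_sub_distrib]; abel
    have hle : ‖stepMap b c f g L h w y z - stepMap b c f g L h w y z'‖ ≤
        (|h| + ∑ r, |w r|) * (41 * C ^ 14 * ‖z - z'‖) := by
      rw [e, add_mul, Finset.sum_mul]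
      refine (norm_add_le _ _).trans (add_le_add ?_ (norm_sum_le_of_le _ fun r _ ↦ ?_)) <;>
        rw [norm_smul, Real.norm_eq_abs] <;> gcongr
      · exact norm_projQuadSum_sub_le hB (hB.norm_quadSum_drift_le y z)
          (hB.norm_quadSum_drift_sub_le y z z') (hmem hz) (hmem hz')
      · exact norm_projQuadSum_sub_le hB (hB.norm_quadSum_noise_le r y z)
          (hB.norm_quadSum_noise_sub_le r y z z') (hmem hz) (hmem hz')
    calc _ ≤ (82 * C ^ 14)⁻¹ * (41 * C ^ 14 * ‖z - z'‖) := hle.trans (by gcongr)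
      _ = _ := by push_cast; field_simp; ring
  have hys : y ∈ s := Metric.mem_closedBall_self (by positivity)
  have hcontr : ContractingWith (1 / 2 : ℝ≥0) (hmaps.restrict _ s s) :=
    ⟨by rw [div_lt_one two_pos]; exact one_lt_two, hmaps.lipschitzOnWith_iff_restrict.1 hlip⟩
  obtain ⟨z, hz, hfix, hlim, -⟩ := hcontr.exists_fixedPoint' Metric.isClosed_closedBall.isComplete
    hmaps hys (edist_ne_top _ _)
  exact ⟨z, hmem hz, hfix, hlim⟩

/-- The implicit equation of a step is solved, for small data, by a measurable function of the
starting point and the noise. -/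
lemma exists_measurable_step (hB : StepBounds b c f g L C) (hf : Continuous f)
    (hg : ∀ r, Continuous (g r)) (hL : Continuous (fderiv ℝ L)) (h : ℝ) :
    ∃ Θ : EuclideanSpace ℝ (Fin m) × (Fin D → ℝ) → EuclideanSpace ℝ (Fin m), Measurable Θ ∧
      ∀ y w, |h| + ∑ r, |w r| ≤ (82 * C ^ 14)⁻¹ →
        IsStep b c f g L h w y (Θ (y, w))
          (normalCoeff (quadSum b c (fderiv ℝ L) y (Θ (y, w))) (quadSum b c f y (Θ (y, w))))
          (fun r ↦ normalCoeff (quadSum b c (fderiv ℝ L) y (Θ (y, w)))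
            (quadSum b c (g r) y (Θ (y, w)))) := by
  have hiter (n : ℕ) : Measurable fun p : EuclideanSpace ℝ (Fin m) × (Fin D → ℝ) ↦
      (stepMap b c f g L h p.2 p.1)^[n] p.1 := by
    induction n with
    | zero => exact measurable_fst
    | succ n ih =>
      simp only [Function.iterate_succ_apply']
      exact (measurable_stepMap hf hg hL b c h).comp (measurable_id.prodMk ih)
  refine ⟨fun p ↦ limUnder atTop fun n ↦ (stepMap b c f g L h p.2 p.1)^[n] p.1,
    (StronglyMeasurable.limUnder fun n ↦ (hiter n).stronglyMeasurable).measurable,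
    fun y w hw ↦ ?_⟩
  obtain ⟨z, hz, hfix, hlim⟩ := exists_fixedPoint_stepMap hB hw y
  simp only [hlim.limUnder_eq]
  exact ⟨hfix.symm, normalCoeff_spec (hB.le_adjoint_quadSum hz) _,
    fun r ↦ normalCoeff_spec (hB.le_adjoint_quadSum hz) _⟩

end Existence

/-! ### Expansion of the invariant along a step -/

open ContinuousLinearMap
open scoped Nat

section Taylor

/-- Taylor's formula with the remainder bounded by the highest derivative. -/
lemma norm_sub_taylor_le {V G : Type*} [NormedAddCommGroup V] [NormedSpace ℝ V]
    [NormedAddCommGroup G] [NormedSpace ℝ G] [CompleteSpace G] {ψ : V → G} {n : ℕ} {K : ℝ}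
    (hψ : ContDiff ℝ (n + 1) ψ) (hK : ∀ x, ‖iteratedFDeriv ℝ (n + 1) ψ x‖ ≤ K) (x y : V) :
    ‖ψ (x + y) - ∑ k ∈ Finset.range (n + 1), (k ! : ℝ)⁻¹ • iteratedFDeriv ℝ k ψ x (fun _ ↦ y)‖ ≤
      K * ‖y‖ ^ (n + 1) := by
  have hK0 : 0 ≤ K := (norm_nonneg _).trans (hK x)
  rw [map_add_eq_sum_add_integral_iteratedFDeriv (n := n) fun t _ ↦ hψ.contDiffAt,
    add_sub_cancel_left, norm_smul, norm_inv, RCLike.norm_natCast]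
  have h1 : ‖∫ t in (0 : ℝ)..1, (1 - t) ^ n • iteratedFDeriv ℝ (n + 1) ψ (x + t • y) fun _ ↦ y‖ ≤
      K * ‖y‖ ^ (n + 1) * |1 - 0| := by
    refine intervalIntegral.norm_integral_le_of_norm_le_const fun t ht ↦ ?_
    rw [Set.uIoc_of_le zero_le_one] at ht
    rw [norm_smul, norm_pow, Real.norm_eq_abs, abs_of_nonneg (by linarith [ht.2])]
    have h2 : (1 - t) ^ n ≤ 1 := pow_le_one₀ (by linarith [ht.2]) (by linarith [ht.1])
    have h3 : ‖iteratedFDeriv ℝ (n + 1) ψ (x + t • y) fun _ ↦ y‖ ≤ K * ‖y‖ ^ (n + 1) := by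
      refine (ContinuousMultilinearMap.le_opNorm _ _).trans ?_
      simp only [Finset.prod_const, Finset.card_univ, Fintype.card_fin]
      gcongr
      exact hK _
    calc _ ≤ 1 * (K * ‖y‖ ^ (n + 1)) := by
          refine mul_le_mul h2 h3 (norm_nonneg _) zero_le_one
      _ = _ := one_mul _
  have h4 : ((n ! : ℝ))⁻¹ ≤ 1 := inv_le_one_of_one_le₀ (by exact_mod_cast n.factorial_pos)
  calc _ ≤ 1 * (K * ‖y‖ ^ (n + 1) * |1 - 0|) := by gcongr
    _ = _ := by simp

variable {m ν M : ℕ} {L : EuclideanSpace ℝ (Fin m) → EuclideanSpace ℝ (Fin ν)} {b c : Fin M → ℝ}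
  {q : ℕ}

/-- The factor of the leading term in the error of the quadrature formula. It is the error for
the monomial `x ^ q`, divided by `q !`. -/
noncomputable def quadConst (b c : Fin M → ℝ) (q : ℕ) : ℝ :=
  (q ! : ℝ)⁻¹ * (((q : ℝ) + 1)⁻¹ - ∑ i, b i * c i ^ q)

/-- Along a segment with direction `Δ`, the increment of `L` and its quadrature approximation
differ by a multiple of `D^{q+1} L (Δ, …, Δ)`, up to order `q + 2`. -/
lemma norm_sub_quadSum_fderiv_le (hL : ContDiff ℝ (q + 1 + 1) L)
    {K : ℝ} (hK : ∀ x, ‖iteratedFDeriv ℝ (q + 2) L x‖ ≤ K) (hbc : HasQuadratureOrder b c q)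
    (y Δ : EuclideanSpace ℝ (Fin m)) :
    ‖L (y + Δ) - L y - quadSum b c (fderiv ℝ L) y (y + Δ) Δ -
        quadConst b c q • iteratedFDeriv ℝ (q + 1) L y (fun _ ↦ Δ)‖ ≤
      K * (1 + ∑ i, |b i| * |c i| ^ (q + 1)) * ‖Δ‖ ^ (q + 2) := by
  set a : ℕ → EuclideanSpace ℝ (Fin ν) := fun k ↦ iteratedFDeriv ℝ (k + 1) L y (fun _ ↦ Δ) with ha
  have hDL : ContDiff ℝ (q + 1) (fderiv ℝ L) := hL.fderiv_right le_rfl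
  have hKD : ∀ x, ‖iteratedFDeriv ℝ (q + 1) (fderiv ℝ L) x‖ ≤ K := fun x ↦ by
    rw [norm_iteratedFDeriv_fderiv]; exact hK x
  have hL1 := norm_sub_taylor_le (n := q + 1) (ψ := L) (by exact_mod_cast hL) hK y Δ
  rw [Finset.sum_range_succ'] at hL1
  have hstep (i : Fin M) : ‖fderiv ℝ L (y + c i • Δ) Δ -
      ∑ k ∈ Finset.range (q + 1), ((k ! : ℝ)⁻¹ * c i ^ k) • a k‖ ≤
      K * |c i| ^ (q + 1) * ‖Δ‖ ^ (q + 2) := by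
    have h1 := norm_sub_taylor_le (n := q) hDL hKD y (c i • Δ)
    have h2 : ∑ k ∈ Finset.range (q + 1), ((k ! : ℝ)⁻¹ * c i ^ k) • a k =
        (∑ k ∈ Finset.range (q + 1),
          (k ! : ℝ)⁻¹ • iteratedFDeriv ℝ k (fderiv ℝ L) y (fun _ ↦ c i • Δ)) Δ := by
      rw [sum_apply]
      refine Finset.sum_congr rfl fun k _ ↦ ?_
      have h3 := (iteratedFDeriv ℝ k (fderiv ℝ L) y).map_smul_univ (fun _ ↦ c i) (fun _ ↦ Δ)
      rw [Finset.prod_const, Finset.card_univ, Fintype.card_fin] at h3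
      rw [h3, smul_smul, smul_apply, ha]
      simp only [iteratedFDeriv_succ_apply_right]
      rfl
    rw [h2, ← sub_apply]
    refine (le_opNorm _ _).trans ((mul_le_mul_of_nonneg_right h1 (norm_nonneg _)).trans_eq ?_)
    rw [norm_smul, Real.norm_eq_abs]
    ring
  have hquad : quadSum b c (fderiv ℝ L) y (y + Δ) Δ = ∑ i, b i • fderiv ℝ L (y + c i • Δ) Δ := by
    simp [quadSum, sum_apply]
  -- below the order of the formula the quadrature is exact, so only the term `k = q` survives
  have hmain : ∑ k ∈ Finset.range (q + 1), (((k + 1) ! : ℕ) : ℝ)⁻¹ • a k -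
      ∑ i, b i • ∑ k ∈ Finset.range (q + 1), ((k ! : ℝ)⁻¹ * c i ^ k) • a k =
      quadConst b c q • a q := by
    have h1 : ∑ i, b i • ∑ k ∈ Finset.range (q + 1), ((k ! : ℝ)⁻¹ * c i ^ k) • a k =
        ∑ k ∈ Finset.range (q + 1), ((k ! : ℝ)⁻¹ * ∑ i, b i * c i ^ k) • a k := by
      simp only [Finset.smul_sum, Finset.mul_sum, Finset.sum_smul]
      rw [Finset.sum_comm]
      refine Finset.sum_congr rfl fun k _ ↦ Finset.sum_congr rfl fun i _ ↦ ?_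
      rw [smul_smul]; ring_nf
    have h2 (k : ℕ) : ((((k + 1) ! : ℕ) : ℝ))⁻¹ = (k ! : ℝ)⁻¹ * ((k : ℝ) + 1)⁻¹ := by
      rw [Nat.factorial_succ]; push_cast; rw [mul_inv, mul_comm]
    rw [h1, Finset.sum_range_succ, Finset.sum_range_succ]
    have h3 : ∑ k ∈ Finset.range q, ((((k + 1) ! : ℕ) : ℝ))⁻¹ • a k =
        ∑ k ∈ Finset.range q, ((k ! : ℝ)⁻¹ * ∑ i, b i * c i ^ k) • a k := by
      refine Finset.sum_congr rfl fun k hk ↦ ?_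
      rw [hbc.sum_mul_pow (Finset.mem_range.1 hk), h2]
    rw [h3, h2, quadConst, mul_sub, sub_smul]
    abel
  have hsplit : L (y + Δ) - L y - quadSum b c (fderiv ℝ L) y (y + Δ) Δ - quadConst b c q • a q =
      (L (y + Δ) - (∑ k ∈ Finset.range (q + 1),
          (((k + 1) ! : ℕ) : ℝ)⁻¹ • iteratedFDeriv ℝ (k + 1) L y (fun _ ↦ Δ) +
          ((0 ! : ℕ) : ℝ)⁻¹ • iteratedFDeriv ℝ 0 L y (fun _ ↦ Δ))) -
        ∑ i, b i • (fderiv ℝ L (y + c i • Δ) Δ -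
          ∑ k ∈ Finset.range (q + 1), ((k ! : ℝ)⁻¹ * c i ^ k) • a k) := by
    rw [← hmain, hquad]
    simp only [smul_sub, Finset.sum_sub_distrib, ha, iteratedFDeriv_zero_apply, Nat.factorial_zero,
      Nat.cast_one, inv_one, one_smul]
    abel
  rw [hsplit]
  calc _ ≤ K * ‖Δ‖ ^ (q + 2) + ∑ i, |b i| * (K * |c i| ^ (q + 1) * ‖Δ‖ ^ (q + 2)) := by
        refine (norm_sub_le _ _).trans (add_le_add hL1 (norm_sum_le_of_le _ fun i _ ↦ ?_))
        rw [norm_smul, Real.norm_eq_abs]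
        gcongr
        exact hstep i
    _ = _ := by
        rw [mul_add, mul_one, add_mul, Finset.mul_sum, Finset.sum_mul]
        congr 1
        exact Finset.sum_congr rfl fun i _ ↦ by ring

end Taylor

section LocalError

variable {m ν D M : ℕ} {f : EuclideanSpace ℝ (Fin m) → EuclideanSpace ℝ (Fin m)}
    {g : Fin D → EuclideanSpace ℝ (Fin m) → EuclideanSpace ℝ (Fin m)}
    {L : EuclideanSpace ℝ (Fin m) → EuclideanSpace ℝ (Fin ν)}
    {b c : Fin M → ℝ} {C : ℝ} {q : ℕ}

/-- The leading term of the increment of `L` in one step from `y` with noise `w`. It is homogeneous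
of degree `q + 1` in the noise. -/
noncomputable def leadTerm (b c : Fin M → ℝ)
    (g : Fin D → EuclideanSpace ℝ (Fin m) → EuclideanSpace ℝ (Fin m))
    (L : EuclideanSpace ℝ (Fin m) → EuclideanSpace ℝ (Fin ν)) (q : ℕ)
    (y : EuclideanSpace ℝ (Fin m)) (w : Fin D → ℝ) : EuclideanSpace ℝ (Fin ν) :=
  quadConst b c q • iteratedFDeriv ℝ (q + 1) L y (fun _ ↦ ∑ r, w r • g r y)

lemma leadTerm_neg_of_even (hq : Even q) (y : EuclideanSpace ℝ (Fin m)) (w : Fin D → ℝ) :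
    leadTerm b c g L q y (-w) = -leadTerm b c g L q y w := by
  have h : ∑ r, (-w) r • g r y = (-1 : ℝ) • ∑ r, w r • g r y := by
    simp [Finset.sum_neg_distrib]
  rw [leadTerm, leadTerm, h]
  have h2 := (iteratedFDeriv ℝ (q + 1) L y).map_smul_univ (fun _ ↦ (-1 : ℝ))
    (fun _ ↦ ∑ r, w r • g r y)
  rw [h2, Finset.prod_const, Finset.card_univ, Fintype.card_fin, hq.add_one.neg_one_pow]
  simp

lemma continuous_leadTerm (hL : ContDiff ℝ (q + 1) L) (hg : ∀ r, Continuous (g r)) :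
    Continuous fun p : EuclideanSpace ℝ (Fin m) × (Fin D → ℝ) ↦
      leadTerm b c g L q p.1 p.2 := by
  unfold leadTerm
  have h1 : Continuous fun p : EuclideanSpace ℝ (Fin m) × (Fin D → ℝ) ↦
      iteratedFDeriv ℝ (q + 1) L p.1 :=
    (hL.continuous_iteratedFDeriv (m := q + 1) (by norm_cast)).comp continuous_fst
  have h2 : Continuous fun p : EuclideanSpace ℝ (Fin m) × (Fin D → ℝ) ↦
      ∑ r, p.2 r • g r p.1 :=
    continuous_finsetSum _ fun r _ ↦ by have := hg r; fun_prop
  fun_prop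

lemma StepBounds.norm_sum_noise_le (hB : StepBounds b c f g L C) (y : EuclideanSpace ℝ (Fin m))
    (w : Fin D → ℝ) : ‖∑ r, w r • g r y‖ ≤ C * ∑ r, |w r| := by
  rw [Finset.mul_sum]
  refine norm_sum_le_of_le _ fun r _ ↦ ?_
  rw [norm_smul, Real.norm_eq_abs, mul_comm]
  gcongr
  exact hB.norm_noise_le r y

lemma norm_leadTerm_le (hB : StepBounds b c f g L C) {K : ℝ}
    (hK : ∀ x, ‖iteratedFDeriv ℝ (q + 1) L x‖ ≤ K) (y : EuclideanSpace ℝ (Fin m))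
    (w : Fin D → ℝ) :
    ‖leadTerm b c g L q y w‖ ≤ |quadConst b c q| * (K * C ^ (q + 1)) * (∑ r, |w r|) ^ (q + 1) := by
  rw [leadTerm, norm_smul, Real.norm_eq_abs, mul_assoc]
  gcongr
  refine (ContinuousMultilinearMap.le_opNorm _ _).trans ?_
  simp only [Finset.prod_const, Finset.card_univ, Fintype.card_fin]
  have hK0 : 0 ≤ K := (norm_nonneg _).trans (hK y)
  calc _ ≤ K * (C * ∑ r, |w r|) ^ (q + 1) := by
        gcongr
        · exact hK y
        · exact hB.norm_sum_noise_le y w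
    _ = _ := by ring

/-- To first order a step moves by the noise alone: as `∇L g_r = 0`, the modification changes the
averaged noise coefficients only in higher order. -/
lemma IsStep.norm_sub_sum_noise_le (hB : StepBounds b c f g L C) (hinv : IsInvariant f g L)
    {h : ℝ} {w : Fin D → ℝ} (h0 : 0 ≤ h) (h1 : h ≤ 1)
    (hw : h + ∑ r, |w r| ≤ (82 * C ^ 14)⁻¹)
    {y y' : EuclideanSpace ℝ (Fin m)} {α₀ : EuclideanSpace ℝ (Fin ν)}
    {α : Fin D → EuclideanSpace ℝ (Fin ν)} (hs : IsStep b c f g L h w y y' α₀ α) :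
    ‖y' - y - ∑ r, w r • g r y‖ ≤ 6 * C ^ 7 * (√h + ∑ r, |w r|) ^ 2 := by
  have hC := hB.one_le
  have hC0 : 0 < C := zero_lt_one.trans_le hC
  have hlen := hs.norm_displacement_le hB
  rw [abs_of_nonneg h0] at hlen
  have hS : 0 ≤ ∑ r, |w r| := Finset.sum_nonneg fun _ _ ↦ abs_nonneg _
  have hsq : √h ^ 2 = h := Real.sq_sqrt h0
  have hle : h ≤ √h := by
    rw [← hsq, Real.sqrt_sq (Real.sqrt_nonneg h)]
    have : √h ≤ 1 := Real.sqrt_le_one.2 h1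
    nlinarith [Real.sqrt_nonneg h]
  have hnear : C ^ 3 * ‖y' - y‖ ≤ 1 / 2 := by
    have h5 : C ^ 5 ≤ C ^ 14 := pow_le_pow_right₀ hC (by norm_num)
    calc _ ≤ C ^ 3 * (C ^ 2 * (82 * C ^ 14)⁻¹) := by gcongr; exact hlen.trans (by gcongr)
      _ = C ^ 5 / (82 * C ^ 14) := by field_simp
      _ ≤ 1 / 2 := by
        rw [div_le_div_iff₀ (by positivity) two_pos]
        have : 0 < C ^ 14 := by positivity
        linarith
  obtain ⟨e1, e2, e3⟩ := hs
  set A := quadSum b c (fderiv ℝ L) y y' with hA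
  set S := √h + ∑ r, |w r| with hSdef
  have hlenS : ‖y' - y‖ ≤ C ^ 2 * S := hlen.trans (by rw [hSdef]; gcongr)
  have hS0 : 0 ≤ S := by positivity
  have key (r : Fin D) : ‖quadSum b c (g r) y y' - adjoint A (α r) - g r y‖ ≤ 5 * C ^ 7 * S := by
    have d1 : ‖quadSum b c (g r) y y' - g r y‖ ≤ C ^ 2 * ‖y' - y‖ := by
      simpa [quadSum_self hB.sum_weights] using hB.norm_quadSum_noise_sub_le r y y' y
    have d2 : ‖A - fderiv ℝ L y‖ ≤ C ^ 2 * ‖y' - y‖ := by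
      simpa [quadSum_self hB.sum_weights] using hB.norm_quadSum_fderiv_sub_le y y' y
    -- `A` almost annihilates the averaged coefficient, because `∇L(y) g_r(y) = 0`
    have d3 : ‖A (quadSum b c (g r) y y')‖ ≤ 2 * C ^ 4 * ‖y' - y‖ := by
      have e : A (quadSum b c (g r) y y') =
          A (quadSum b c (g r) y y' - g r y) + (A - fderiv ℝ L y) (g r y) := by
        simp [(hinv.2 y).2 r]
      rw [e]
      have h34 : C ^ 3 ≤ C ^ 4 := pow_le_pow_right₀ hC (by norm_num)
      calc _ ≤ C ^ 2 * (C ^ 2 * ‖y' - y‖) + C ^ 2 * ‖y' - y‖ * C := by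
            refine (norm_add_le _ _).trans (add_le_add ((le_opNorm _ _).trans ?_)
              ((le_opNorm _ _).trans ?_))
            · gcongr
              exact hB.norm_quadSum_fderiv_le y y'
            · gcongr
              exact hB.norm_noise_le r y
        _ = (C ^ 4 + C ^ 3) * ‖y' - y‖ := by ring
        _ ≤ _ := by gcongr; linarith
    have d4 := norm_adjoint_le_of_normal_eq (hB.le_adjoint_quadSum hnear) (e3 r)
    have h25 : C ^ 2 ≤ C ^ 5 := pow_le_pow_right₀ hC (by norm_num)
    calc _ = ‖(quadSum b c (g r) y y' - g r y) - adjoint A (α r)‖ := by congr 1; abel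
      _ ≤ C ^ 2 * ‖y' - y‖ + 2 * C * (2 * C ^ 4 * ‖y' - y‖) :=
          (norm_sub_le _ _).trans (add_le_add d1 (d4.trans (by gcongr)))
      _ = (C ^ 2 + 4 * C ^ 5) * ‖y' - y‖ := by ring
      _ ≤ (5 * C ^ 5) * (C ^ 2 * S) := by gcongr; linarith
      _ = _ := by ring
  have e : y' - y - ∑ r, w r • g r y = h • (quadSum b c f y y' - adjoint A α₀) +
      ∑ r, w r • (quadSum b c (g r) y y' - adjoint A (α r) - g r y) := by
    have : ∑ r, w r • (quadSum b c (g r) y y' - adjoint A (α r) - g r y) =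
        ∑ r, w r • (quadSum b c (g r) y y' - adjoint A (α r)) - ∑ r, w r • g r y := by
      rw [← Finset.sum_sub_distrib]
      exact Finset.sum_congr rfl fun r _ ↦ smul_sub _ _ _
    rw [this]
    nth_rewrite 1 [e1]
    abel
  rw [e]
  have h27 : C ^ 2 ≤ C ^ 7 := pow_le_pow_right₀ hC (by norm_num)
  have hhS : h ≤ S ^ 2 := by
    nlinarith [Real.sqrt_nonneg h]
  have hwS : ∑ r, |w r| ≤ S := by linarith [Real.sqrt_nonneg h]
  calc _ ≤ h * C ^ 2 + ∑ r, |w r| * (5 * C ^ 7 * S) := by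
        refine (norm_add_le _ _).trans (add_le_add ?_ (norm_sum_le_of_le _ fun r _ ↦ ?_))
        · rw [norm_smul, Real.norm_eq_abs, abs_of_nonneg h0]
          gcongr
          exact (norm_sub_adjoint_le _ e2).trans (hB.norm_quadSum_drift_le y y')
        · rw [norm_smul, Real.norm_eq_abs]
          gcongr
          exact key r
    _ = h * C ^ 2 + (∑ r, |w r|) * (5 * C ^ 7 * S) := by rw [Finset.sum_mul]
    _ ≤ S ^ 2 * C ^ 7 + S * (5 * C ^ 7 * S) := by gcongr
    _ = _ := by ring

lemma IsStep.quadSum_fderiv_sub_eq_zero {h : ℝ} {w : Fin D → ℝ}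
    {y y' : EuclideanSpace ℝ (Fin m)} {α₀ : EuclideanSpace ℝ (Fin ν)}
    {α : Fin D → EuclideanSpace ℝ (Fin ν)} (hs : IsStep b c f g L h w y y' α₀ α) :
    quadSum b c (fderiv ℝ L) y y' (y' - y) = 0 := by
  obtain ⟨e1, e2, e3⟩ := hs
  set A := quadSum b c (fderiv ℝ L) y y' with hA
  have e : y' - y = h • (quadSum b c f y y' - adjoint A α₀) +
      ∑ r, w r • (quadSum b c (g r) y y' - adjoint A (α r)) := by
    nth_rewrite 1 [e1]; abel
  rw [e]
  simp [map_sum, e2, e3]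

/-- The increment of the invariant in one step is its leading term, up to order `q + 2` in the
size `√h + ∑ |w_r|` of the data. -/
lemma exists_norm_sub_leadTerm_le (hB : StepBounds b c f g L C) (hinv : IsInvariant f g L)
    (hL : ContDiff ℝ (q + 1 + 1) L) {K : ℝ} (hK₁ : ∀ x, ‖iteratedFDeriv ℝ (q + 1) L x‖ ≤ K)
    (hK₂ : ∀ x, ‖iteratedFDeriv ℝ (q + 2) L x‖ ≤ K) (hbc : HasQuadratureOrder b c q) :
    ∃ K' : ℝ, ∀ (h : ℝ) (w : Fin D → ℝ) (y y' : EuclideanSpace ℝ (Fin m))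
      (α₀ : EuclideanSpace ℝ (Fin ν)) (α : Fin D → EuclideanSpace ℝ (Fin ν)), 0 ≤ h → h ≤ 1 →
      h + ∑ r, |w r| ≤ (82 * C ^ 14)⁻¹ → IsStep b c f g L h w y y' α₀ α →
      ‖L y' - L y - leadTerm b c g L q y w‖ ≤ K' * (√h + ∑ r, |w r|) ^ (q + 2) := by
  refine ⟨K * (1 + ∑ i, |b i| * |c i| ^ (q + 1)) * (C ^ 2) ^ (q + 2) +
    |quadConst b c q| * (K * ((q + 1 : ℕ) : ℝ) * (C ^ 2) ^ q * (6 * C ^ 7)),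
    fun h w y y' α₀ α h0 h1 hw hs ↦ ?_⟩
  have hC := hB.one_le
  have hC0 : 0 < C := zero_lt_one.trans_le hC
  have hK0 : 0 ≤ K := (norm_nonneg _).trans (hK₁ y)
  have hlen := hs.norm_displacement_le hB
  rw [abs_of_nonneg h0] at hlen
  have hS : 0 ≤ ∑ r, |w r| := Finset.sum_nonneg fun _ _ ↦ abs_nonneg _
  have hle : h ≤ √h := by
    have hsq : √h ^ 2 = h := Real.sq_sqrt h0
    have : √h ≤ 1 := Real.sqrt_le_one.2 h1
    nlinarith [Real.sqrt_nonneg h]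
  have hfirst := hs.norm_sub_sum_noise_le hB hinv h0 h1 hw
  have hv := hB.norm_sum_noise_le y w
  set S := √h + ∑ r, |w r| with hSdef
  have hS0 : 0 ≤ S := by positivity
  set Δ := y' - y with hΔ
  set v := ∑ r, w r • g r y with hvdef
  have hΔS : ‖Δ‖ ≤ C ^ 2 * S := hlen.trans (by rw [hSdef]; gcongr)
  have hvS : ‖v‖ ≤ C ^ 2 * S := by
    have : C ≤ C ^ 2 := by nlinarith
    exact hv.trans (by gcongr; linarith [Real.sqrt_nonneg h])
  have t1 := norm_sub_quadSum_fderiv_le hL hK₂ hbc y Δ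
  have hy' : y + Δ = y' := by rw [hΔ]; abel
  rw [hy', hs.quadSum_fderiv_sub_eq_zero, sub_zero] at t1
  have t2 : ‖iteratedFDeriv ℝ (q + 1) L y (fun _ ↦ Δ) -
      iteratedFDeriv ℝ (q + 1) L y (fun _ ↦ v)‖ ≤
      K * ((q + 1 : ℕ) : ℝ) * (C ^ 2 * S) ^ q * (6 * C ^ 7 * S ^ 2) := by
    refine (ContinuousMultilinearMap.norm_image_sub_le _ _ _).trans ?_
    have hsub : (fun _ : Fin (q + 1) ↦ Δ) - (fun _ ↦ v) = fun _ ↦ Δ - v := rfl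
    rw [hsub, pi_norm_const, pi_norm_const, pi_norm_const, Fintype.card_fin, Nat.add_sub_cancel]
    have hmax : max ‖Δ‖ ‖v‖ ≤ C ^ 2 * S := max_le hΔS hvS
    have hmax0 : 0 ≤ max ‖Δ‖ ‖v‖ := le_max_of_le_left (norm_nonneg _)
    gcongr
    exact hK₁ y
  have hb0 : 0 ≤ ∑ i, |b i| * |c i| ^ (q + 1) := Finset.sum_nonneg fun _ _ ↦ by positivity
  calc ‖L y' - L y - leadTerm b c g L q y w‖ =
        ‖(L y' - L y - quadConst b c q • iteratedFDeriv ℝ (q + 1) L y (fun _ ↦ Δ)) +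
          quadConst b c q • (iteratedFDeriv ℝ (q + 1) L y (fun _ ↦ Δ) -
            iteratedFDeriv ℝ (q + 1) L y (fun _ ↦ v))‖ := by
        rw [leadTerm, ← hvdef, smul_sub]; congr 1; abel
    _ ≤ K * (1 + ∑ i, |b i| * |c i| ^ (q + 1)) * (C ^ 2 * S) ^ (q + 2) +
          |quadConst b c q| * (K * ((q + 1 : ℕ) : ℝ) * (C ^ 2 * S) ^ q * (6 * C ^ 7 * S ^ 2)) := by
        refine (norm_add_le _ _).trans (add_le_add (t1.trans (by gcongr)) ?_)
        rw [norm_smul, Real.norm_eq_abs]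
        gcongr
    _ = _ := by
        rw [mul_pow _ S, mul_pow _ S, pow_add S]
        ring1

end LocalError

/-! ### The noise -/

section Truncation

lemma truncIncr_neg (h w : ℝ) : truncIncr h (-w) = -truncIncr h w := by
  have hA : 0 ≤ √(4 * |Real.log h|) := Real.sqrt_nonneg _
  rw [truncIncr, truncIncr, neg_div, ← mul_neg]
  congr 1
  generalize w / √h = x at *
  generalize √(4 * |Real.log h|) = A at *
  grind

/-- The truncated increments are bounded by a deterministic quantity that vanishes with `h`. -/
lemma abs_truncIncr_le (h w : ℝ) : |truncIncr h w| ≤ √(4 * |h * Real.log h|) := by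
  have hA : 0 ≤ √(4 * |Real.log h|) := Real.sqrt_nonneg _
  rcases le_or_gt h 0 with h0 | h0
  · rw [truncIncr, Real.sqrt_eq_zero_of_nonpos h0, zero_mul, abs_zero]
    exact Real.sqrt_nonneg _
  · have e : √(4 * |h * Real.log h|) = √h * √(4 * |Real.log h|) := by
      rw [← Real.sqrt_mul h0.le, abs_mul, abs_of_pos h0]
      ring_nf
    rw [e, truncIncr, abs_mul, abs_of_nonneg (Real.sqrt_nonneg h)]
    gcongr
    rw [abs_le]
    exact ⟨le_max_left _ _, max_le (by linarith) (min_le_right _ _)⟩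

lemma abs_truncIncr_le_mul (h w : ℝ) : |truncIncr h w| ≤ √h * |w / √h| := by
  have hA : 0 ≤ √(4 * |Real.log h|) := Real.sqrt_nonneg _
  rw [truncIncr, abs_mul, abs_of_nonneg (Real.sqrt_nonneg h)]
  refine mul_le_mul_of_nonneg_left (abs_le.2 ?_) (Real.sqrt_nonneg h)
  exact ⟨le_max_of_le_right (le_min (neg_abs_le _) (by linarith [abs_nonneg (w / √h)])),
    max_le (by linarith [abs_nonneg (w / √h)]) ((min_le_left _ _).trans (le_abs_self _))⟩

lemma continuous_truncIncr (h : ℝ) : Continuous (truncIncr h) := by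
  unfold truncIncr
  fun_prop

/-- For small step sizes, step size and truncated noise together are uniformly small. -/
lemma exists_forall_add_sum_truncIncr_le (D : ℕ) {ρ : ℝ} (hρ : 0 < ρ) :
    ∃ h₀ > (0 : ℝ), h₀ ≤ 1 ∧ ∀ h, 0 ≤ h → h ≤ h₀ → ∀ u : Fin D → ℝ,
      h + ∑ r, |truncIncr h (u r)| ≤ ρ := by
  have hcont : Continuous fun h : ℝ ↦ h + D * √(4 * |h * Real.log h|) := by
    have := Real.continuous_mul_log
    fun_prop
  have h0 := hcont.tendsto 0
  simp only [zero_mul, abs_zero, mul_zero, Real.sqrt_zero, add_zero] at h0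
  obtain ⟨δ, hδ, hball⟩ := Metric.eventually_nhds_iff.1 (h0.eventually_lt_const hρ)
  refine ⟨min (δ / 2) 1, by positivity, min_le_right _ _, fun h hh hle u ↦ ?_⟩
  have h1 : h < δ := by linarith [hle.trans (min_le_left _ _)]
  have h2 := hball (y := h) (by rwa [Real.dist_eq, sub_zero, abs_of_nonneg hh])
  have h3 : ∑ r, |truncIncr h (u r)| ≤ ∑ _r : Fin D, √(4 * |h * Real.log h|) :=
    Finset.sum_le_sum fun r _ ↦ abs_truncIncr_le h (u r)
  rw [Finset.sum_const, Finset.card_univ, Fintype.card_fin, nsmul_eq_mul] at h3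
  linarith

end Truncation

section Noise

variable {Ω : Type*} {mΩ : MeasurableSpace Ω} {P : Measure Ω} {D : ℕ}
  {𝓕 : Filtration ℝ≥0 mΩ} {W : Fin D → ℝ≥0 → Ω → ℝ}

lemma IsBrownianFamily.measurable (hW : IsBrownianFamily 𝓕 W P) (r : Fin D) (t : ℝ≥0) :
    Measurable (W r t) := (hW.adapted r t).mono (𝓕.le t) le_rfl

lemma IsBrownianFamily.measurable_increment (hW : IsBrownianFamily 𝓕 W P) (s t : ℝ≥0) :
    Measurable fun ω r ↦ W r t ω - W r s ω :=
  measurable_pi_lambda _ fun r ↦ (hW.measurable r t).sub (hW.measurable r s)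

/-- The scaled increments of the family have independent centered Gaussian components. -/
lemma IsBrownianFamily.hasLaw_increment_div [IsProbabilityMeasure P]
    (hW : IsBrownianFamily 𝓕 W P) (s t : ℝ≥0) (c : ℝ) :
    HasLaw (fun ω r ↦ (W r t ω - W r s ω) / c)
      (Measure.pi fun _ ↦ gaussianReal 0 (nndist t.1 s.1 / .mk (c ^ 2) (sq_nonneg _))) P := by
  have hlaw (r : Fin D) : HasLaw (fun ω ↦ (W r t ω - W r s ω) / c)
      (gaussianReal 0 (nndist t.1 s.1 / .mk (c ^ 2) (sq_nonneg _))) P := by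
    simpa using gaussianReal_div_const ((hW.brownian r).hasLaw_sub t s) c
  have hind : iIndepFun (fun r ω ↦ (W r t ω - W r s ω) / c) P :=
    hW.indep.comp (fun _ x ↦ (x t - x s) / c) fun _ ↦ by fun_prop
  refine ⟨aemeasurable_pi_lambda _ fun r ↦ (hlaw r).aemeasurable, ?_⟩
  rw [(iIndepFun_iff_map_fun_eq_pi_map fun r ↦ (hlaw r).aemeasurable).1 hind]
  congr 1
  ext1 r
  exact (hlaw r).map_eq

lemma map_neg_pi_gaussianReal (v : ℝ≥0) :
    (Measure.pi fun _ : Fin D ↦ gaussianReal 0 v).map (fun x ↦ -x) =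
      Measure.pi fun _ ↦ gaussianReal 0 v := by
  have h : MeasurePreserving (fun x : ℝ ↦ -x) (gaussianReal 0 v) (gaussianReal 0 v) :=
    ⟨by fun_prop, by simpa using gaussianReal_map_neg (μ := 0) (v := v)⟩
  exact (measurePreserving_pi (fun _ : Fin D ↦ gaussianReal 0 v) (fun _ ↦ gaussianReal 0 v)
    fun _ ↦ h).map_eq

/-- An odd function of the increments over `[s, t]`, with parameters known at time `s`, has mean
zero. -/
lemma IsBrownianFamily.integral_eq_zero_of_odd [IsProbabilityMeasure P]
    (hW : IsBrownianFamily 𝓕 W P) {s t : ℝ≥0} (hst : s ≤ t) {𝒵 : Type*} [MeasurableSpace 𝒵]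
    {Z : Ω → 𝒵} (hZ : Measurable[𝓕 s] Z) {ψ : 𝒵 × (Fin D → ℝ) → ℝ} (hψ : Measurable ψ)
    (hodd : ∀ z u, ψ (z, -u) = -ψ (z, u)) :
    ∫ ω, ψ (Z ω, fun r ↦ W r t ω - W r s ω) ∂P = 0 := by
  set U : Ω → Fin D → ℝ := fun ω r ↦ W r t ω - W r s ω with hU
  have hUm : Measurable U := hW.measurable_increment s t
  have hZm : Measurable Z := hZ.mono (𝓕.le s) le_rfl
  have hind : IndepFun Z U P := by
    rw [IndepFun_iff_Indep]
    exact indep_of_indep_of_le_left (hW.indep_past s t hst).symm hZ.comap_le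
  have hlaw := (hW.hasLaw_increment_div s t 1).map_eq
  simp only [div_one] at hlaw
  have hsym : P.map U = (P.map U).map (fun x ↦ -x) := by
    rw [hU, hlaw, map_neg_pi_gaussianReal]
  have hprod := (indepFun_iff_map_prod_eq_prod_map_map hZm.aemeasurable hUm.aemeasurable).1 hind
  have : IsProbabilityMeasure (P.map Z) := Measure.isProbabilityMeasure_map hZm.aemeasurable
  have : IsProbabilityMeasure (P.map U) := Measure.isProbabilityMeasure_map hUm.aemeasurable
  have hneg : MeasurePreserving (Prod.map id fun x : Fin D → ℝ ↦ -x)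
      ((P.map Z).prod (P.map U)) ((P.map Z).prod (P.map U)) :=
    (MeasurePreserving.id _).prod ⟨by fun_prop, hsym.symm⟩
  have h1 : ∫ ω, ψ (Z ω, U ω) ∂P = ∫ p, ψ p ∂((P.map Z).prod (P.map U)) := by
    rw [← hprod, integral_map (hZm.prodMk hUm).aemeasurable hψ.aestronglyMeasurable]
  have h2 : ∫ p, ψ p ∂((P.map Z).prod (P.map U)) =
      -∫ p, ψ p ∂((P.map Z).prod (P.map U)) := by
    conv_lhs => rw [← hneg.map_eq]
    rw [integral_map hneg.measurable.aemeasurable hψ.aestronglyMeasurable, ← integral_neg]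
    exact integral_congr_ae (.of_forall fun p ↦ hodd p.1 p.2)
  rw [h1]
  linarith

/-- The moments of `1 + ∑ |x_r|` for a standard Gaussian vector `x`. -/
noncomputable def noiseMoment (D k : ℕ) : ℝ :=
  ∫ x : Fin D → ℝ, (1 + ∑ r, |x r|) ^ k ∂(Measure.pi fun _ ↦ gaussianReal 0 1)

lemma integrable_one_add_sum_abs_pow (D k : ℕ) :
    Integrable (fun x : Fin D → ℝ ↦ (1 + ∑ r, |x r|) ^ k)
      (Measure.pi fun _ ↦ gaussianReal 0 1) := by
  have h1 (r : Fin D) : MemLp (fun x : Fin D → ℝ ↦ |x r|) k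
      (Measure.pi fun _ ↦ gaussianReal 0 1) := by
    have hid := memLp_id_gaussianReal' (μ := 0) (v := 1) k (ENNReal.natCast_ne_top k)
    have := hid.comp_measurePreserving
      (measurePreserving_eval (fun _ : Fin D ↦ gaussianReal 0 1) r)
    exact this.abs
  have h2 : MemLp (fun x : Fin D → ℝ ↦ 1 + ∑ r, |x r|) k
      (Measure.pi fun _ ↦ gaussianReal 0 1) := by
    have h3 := memLp_finsetSum Finset.univ fun r _ ↦ h1 r
    have h4 : MemLp (fun _ : Fin D → ℝ ↦ (1 : ℝ)) k (Measure.pi fun _ ↦ gaussianReal 0 1) :=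
      memLp_const 1
    exact h4.add h3
  refine h2.integrable_norm_pow'.congr (.of_forall fun x ↦ ?_)
  have : 0 ≤ 1 + ∑ r, |x r| := by positivity
  simp [abs_of_nonneg this]

lemma noiseMoment_nonneg (D k : ℕ) : 0 ≤ noiseMoment D k :=
  integral_nonneg fun x ↦ pow_nonneg (by positivity) k

/-- All moments of the size of the data of a step scale like those of a Gaussian with variance the
step size. -/
lemma IsBrownianFamily.integral_size_pow_le [IsProbabilityMeasure P]
    (hW : IsBrownianFamily 𝓕 W P) {s t : ℝ≥0} {h : ℝ} (hh : 0 < h) (hst : (t : ℝ) - s = h)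
    (k : ℕ) :
    Integrable (fun ω ↦ (√h + ∑ r, |truncIncr h (W r t ω - W r s ω)|) ^ (2 * k)) P ∧
    ∫ ω, (√h + ∑ r, |truncIncr h (W r t ω - W r s ω)|) ^ (2 * k) ∂P ≤
      h ^ k * noiseMoment D (2 * k) := by
  have hlaw := hW.hasLaw_increment_div s t √h
  have hvar : nndist t.1 s.1 / .mk (√h ^ 2) (sq_nonneg _) = (1 : ℝ≥0) := by
    ext
    rw [NNReal.coe_div, coe_nndist, Real.dist_eq]
    change |(t : ℝ) - s| / √h ^ 2 = 1
    rw [hst, Real.sq_sqrt hh.le, abs_of_pos hh, div_self hh.ne']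
  rw [hvar] at hlaw
  have hint := integrable_one_add_sum_abs_pow D (2 * k)
  have hint' : Integrable (fun ω ↦ (1 + ∑ r, |(W r t ω - W r s ω) / √h|) ^ (2 * k)) P := by
    rw [← hlaw.map_eq] at hint
    exact hint.comp_aemeasurable hlaw.aemeasurable
  have hle (ω : Ω) : (√h + ∑ r, |truncIncr h (W r t ω - W r s ω)|) ^ (2 * k) ≤
      h ^ k * (1 + ∑ r, |(W r t ω - W r s ω) / √h|) ^ (2 * k) := by
    have e : h ^ k = √h ^ (2 * k) := by rw [pow_mul, Real.sq_sqrt hh.le]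
    rw [e, ← mul_pow, mul_add, mul_one, Finset.mul_sum]
    gcongr
    exact abs_truncIncr_le_mul _ _
  have hmeas : Measurable fun ω ↦ (√h + ∑ r, |truncIncr h (W r t ω - W r s ω)|) ^ (2 * k) := by
    have h1 (r : Fin D) : Measurable fun ω ↦ truncIncr h (W r t ω - W r s ω) :=
      (continuous_truncIncr h).measurable.comp ((hW.measurable r t).sub (hW.measurable r s))
    fun_prop
  have hint2 := (hint'.const_mul (h ^ k)).mono' hmeas.aestronglyMeasurable
    (.of_forall fun ω ↦ by
      rw [Real.norm_eq_abs, abs_of_nonneg (by positivity)]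
      exact hle ω)
  refine ⟨hint2, ?_⟩
  calc _ ≤ ∫ ω, h ^ k * (1 + ∑ r, |(W r t ω - W r s ω) / √h|) ^ (2 * k) ∂P :=
        integral_mono hint2 (hint'.const_mul _) hle
    _ = _ := by
        rw [integral_const_mul, noiseMoment, ← hlaw.map_eq,
          integral_map hlaw.aemeasurable (hlaw.map_eq ▸ hint.aestronglyMeasurable)]

end Noise

/-! ### Mean squares of sums -/

section Sums

variable {Ω : Type*} {mΩ : MeasurableSpace Ω} {P : Measure Ω} {F : Type*}
  [NormedAddCommGroup F]

lemma integral_norm_sq_sum_le {X : ℕ → Ω → F} {N : ℕ} {a : ℝ}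
    (hX : ∀ n < N, MemLp (X n) 2 P) (ha : ∀ n < N, ∫ ω, ‖X n ω‖ ^ 2 ∂P ≤ a) :
    ∫ ω, ‖∑ n ∈ Finset.range N, X n ω‖ ^ 2 ∂P ≤ (N : ℝ) ^ 2 * a := by
  have hint : ∀ n ∈ Finset.range N, Integrable (fun ω ↦ ‖X n ω‖ ^ 2) P := fun n hn ↦
    (hX n (Finset.mem_range.1 hn)).integrable_norm_pow two_ne_zero
  have hle (ω : Ω) : ‖∑ n ∈ Finset.range N, X n ω‖ ^ 2 ≤
      N * ∑ n ∈ Finset.range N, ‖X n ω‖ ^ 2 := by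
    have h1 := pow_le_pow_left₀ (norm_nonneg _)
      (norm_sum_le (Finset.range N) fun n ↦ X n ω) 2
    have h2 := sq_sum_le_card_mul_sum_sq (s := Finset.range N) (f := fun n ↦ ‖X n ω‖)
    rw [Finset.card_range] at h2
    exact h1.trans h2
  calc _ ≤ ∫ ω, N * ∑ n ∈ Finset.range N, ‖X n ω‖ ^ 2 ∂P := by
        refine integral_mono_of_nonneg (.of_forall fun ω ↦ by positivity)
          ((integrable_finsetSum _ hint).const_mul _) (.of_forall hle)
    _ = N * ∑ n ∈ Finset.range N, ∫ ω, ‖X n ω‖ ^ 2 ∂P := by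
        rw [integral_const_mul, integral_finsetSum _ hint]
    _ ≤ N * ∑ _n ∈ Finset.range N, a := by
        gcongr with n hn
        exact ha n (Finset.mem_range.1 hn)
    _ = _ := by rw [Finset.sum_const, Finset.card_range, nsmul_eq_mul]; ring

lemma integral_norm_add_sq_le {X Y : Ω → F} (hX : MemLp X 2 P) (hY : MemLp Y 2 P) :
    ∫ ω, ‖X ω + Y ω‖ ^ 2 ∂P ≤ 2 * ∫ ω, ‖X ω‖ ^ 2 ∂P + 2 * ∫ ω, ‖Y ω‖ ^ 2 ∂P := by
  have i1 := hX.integrable_norm_pow two_ne_zero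
  have i2 := hY.integrable_norm_pow two_ne_zero
  rw [← integral_const_mul, ← integral_const_mul, ← integral_add (i1.const_mul 2) (i2.const_mul 2)]
  refine integral_mono_of_nonneg (.of_forall fun ω ↦ by positivity)
    ((i1.const_mul 2).add (i2.const_mul 2)) (.of_forall fun ω ↦ ?_)
  have h := norm_add_le (X ω) (Y ω)
  have h2 := pow_le_pow_left₀ (norm_nonneg _) h 2
  nlinarith [sq_nonneg (‖X ω‖ - ‖Y ω‖)]

variable [InnerProductSpace ℝ F]

lemma integrable_inner_of_memLp {X Y : Ω → F} (hX : MemLp X 2 P) (hY : MemLp Y 2 P) :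
    Integrable (fun ω ↦ inner ℝ (X ω) (Y ω)) P := by
  refine (hX.norm.integrable_mul hY.norm).mono
    (hX.aestronglyMeasurable.inner hY.aestronglyMeasurable) (.of_forall fun ω ↦ ?_)
  simpa using norm_inner_le_norm (𝕜 := ℝ) (X ω) (Y ω)

/-- For sums with increments orthogonal to the past the factor `N ^ 2` improves to `N`. -/
lemma integral_norm_sq_sum_le_of_orthogonal {X : ℕ → Ω → F} {N : ℕ} {a : ℝ}
    (hX : ∀ n < N, MemLp (X n) 2 P) (ha : ∀ n < N, ∫ ω, ‖X n ω‖ ^ 2 ∂P ≤ a)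
    (horth : ∀ n < N, ∫ ω, inner ℝ (∑ k ∈ Finset.range n, X k ω) (X n ω) ∂P = 0) :
    ∫ ω, ‖∑ n ∈ Finset.range N, X n ω‖ ^ 2 ∂P ≤ N * a := by
  induction N with
  | zero => simp
  | succ N ih =>
    have hS : MemLp (fun ω ↦ ∑ k ∈ Finset.range N, X k ω) 2 P :=
      memLp_finsetSum _ fun n hn ↦ hX n (by have := Finset.mem_range.1 hn; omega)
    have hN := hX N (Nat.lt_succ_self N)
    have ih' := ih (fun n hn ↦ hX n (by omega)) (fun n hn ↦ ha n (by omega))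
      (fun n hn ↦ horth n (by omega))
    have i1 := hS.integrable_norm_pow two_ne_zero
    have i2 := hN.integrable_norm_pow two_ne_zero
    have i3 : Integrable (fun ω ↦ 2 * inner ℝ (∑ k ∈ Finset.range N, X k ω) (X N ω)) P :=
      (integrable_inner_of_memLp hS hN).const_mul 2
    have e : ∫ ω, ‖∑ n ∈ Finset.range (N + 1), X n ω‖ ^ 2 ∂P =
        ∫ ω, ‖∑ k ∈ Finset.range N, X k ω‖ ^ 2 ∂P +
          ∫ ω, 2 * inner ℝ (∑ k ∈ Finset.range N, X k ω) (X N ω) ∂P + ∫ ω, ‖X N ω‖ ^ 2 ∂P := by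
      rw [← integral_add i1 i3, ← integral_add (by exact i1.add i3) i2]
      simp only [Finset.sum_range_succ, norm_add_sq_real]
    rw [e, integral_const_mul, horth N (Nat.lt_succ_self N)]
    push_cast
    linarith [ha N (Nat.lt_succ_self N)]

end Sums

/-! ### The global error -/

section Grid

lemma gridTime_mono (T : ℝ≥0) (N : ℕ) : Monotone (gridTime T N) := fun n k hnk ↦ by
  unfold gridTime
  gcongr

lemma gridTime_zero (T : ℝ≥0) (N : ℕ) : gridTime T N 0 = 0 := by simp [gridTime]

lemma gridTime_succ_sub (T : ℝ≥0) (N n : ℕ) :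
    (gridTime T N (n + 1) : ℝ) - gridTime T N n = T / N := by
  simp only [gridTime, NNReal.coe_mul, NNReal.coe_div, NNReal.coe_natCast]
  push_cast
  ring

variable {Ω : Type*} {mΩ : MeasurableSpace Ω} {P : Measure Ω} {𝓕 : Filtration ℝ≥0 mΩ}
  {m ν D M : ℕ} {W : Fin D → ℝ≥0 → Ω → ℝ} {f : EuclideanSpace ℝ (Fin m) → EuclideanSpace ℝ (Fin m)}
  {g : Fin D → EuclideanSpace ℝ (Fin m) → EuclideanSpace ℝ (Fin m)}
  {L : EuclideanSpace ℝ (Fin m) → EuclideanSpace ℝ (Fin ν)}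
  {b c : Fin M → ℝ} {C : ℝ} {q : ℕ}
  {Y₀ : Ω → EuclideanSpace ℝ (Fin m)} {T : ℝ≥0} {N : ℕ}

/-- The truncated noise of the `n`-th step. -/
noncomputable def stepNoise (W : Fin D → ℝ≥0 → Ω → ℝ) (T : ℝ≥0) (N n : ℕ) (ω : Ω)
    (r : Fin D) : ℝ :=
  truncIncr (T / N) (W r (gridTime T N (n + 1)) ω - W r (gridTime T N n) ω)

lemma IsBrownianFamily.measurable_stepNoise (hW : IsBrownianFamily 𝓕 W P) (T : ℝ≥0) (N n : ℕ) :
    Measurable[𝓕 (gridTime T N (n + 1))] (stepNoise W T N n) := by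
  have h1 (r : Fin D) := hW.adapted r (gridTime T N (n + 1))
  have h2 (r : Fin D) := (hW.adapted r (gridTime T N n)).mono
    (𝓕.mono (gridTime_mono T N n.le_succ)) le_rfl
  refine @measurable_pi_lambda _ _ _ (𝓕 (gridTime T N (n + 1))) _ _ fun r ↦ ?_
  have := (continuous_truncIncr ((T : ℝ) / N)).measurable.comp ((h1 r).sub (h2 r))
  exact this

lemma exists_isDiscretization (hB : StepBounds b c f g L C) (hf : Continuous f)
    (hg : ∀ r, Continuous (g r)) (hL : Continuous (fderiv ℝ L)) (hW : IsBrownianFamily 𝓕 W P)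
    (hY₀ : Measurable[𝓕 0] Y₀)
    (hsmall : ∀ u : Fin D → ℝ,
      (T : ℝ) / N + ∑ r, |truncIncr (T / N) (u r)| ≤ (82 * C ^ 14)⁻¹) :
    ∃ y α₀ α, IsDiscretization 𝓕 P W b c f g L Y₀ T N y α₀ α := by
  obtain ⟨Θ, hΘ, hstep⟩ := exists_measurable_step hB hf hg hL ((T : ℝ) / N)
  let y : ℕ → Ω → EuclideanSpace ℝ (Fin m) := fun n ↦
    Nat.rec Y₀ (fun n yn ω ↦ Θ (yn ω, stepNoise W T N n ω)) n
  have hy (n : ℕ) : Measurable[𝓕 (gridTime T N n)] (y n) := by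
    induction n with
    | zero => rw [gridTime_zero]; exact hY₀
    | succ n ih =>
      have h1 := ih.mono (𝓕.mono (gridTime_mono T N n.le_succ)) le_rfl
      exact hΘ.comp (h1.prodMk (hW.measurable_stepNoise T N n))
  have hpair (n : ℕ) : Measurable[𝓕 (gridTime T N (n + 1))] fun ω ↦ (y n ω, y (n + 1) ω) :=
    ((hy n).mono (𝓕.mono (gridTime_mono T N n.le_succ)) le_rfl).prodMk (hy (n + 1))
  refine ⟨y,
    fun n ω ↦ normalCoeff (quadSum b c (fderiv ℝ L) (y n ω) (y (n + 1) ω))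
      (quadSum b c f (y n ω) (y (n + 1) ω)),
    fun n r ω ↦ normalCoeff (quadSum b c (fderiv ℝ L) (y n ω) (y (n + 1) ω))
      (quadSum b c (g r) (y n ω) (y (n + 1) ω)), rfl, fun n _ ↦ hy n, fun n _ ↦ ?_,
    fun n _ r ↦ ?_, fun n _ ↦ .of_forall fun ω ↦ ?_⟩
  · have := (measurable_normalCoeff_quadSum hf hL b c).comp (hpair n)
    exact this
  · have := (measurable_normalCoeff_quadSum (hg r) hL b c).comp (hpair n)
    exact this
  · refine hstep (y n ω) (stepNoise W T N n ω) ?_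
    rw [abs_of_nonneg (by positivity)]
    exact hsmall _

/-- The mean square of a quantity dominated by a power of the size of the data. -/
lemma IsBrownianFamily.integral_norm_sq_le [IsProbabilityMeasure P] {F : Type*}
    [NormedAddCommGroup F] (hW : IsBrownianFamily 𝓕 W P) (hh : 0 < (T : ℝ) / N) {n k : ℕ}
    {X : Ω → F} (hXm : AEStronglyMeasurable X P) {K : ℝ}
    (hX : ∀ᵐ ω ∂P, ‖X ω‖ ≤ K * (√((T : ℝ) / N) + ∑ r, |stepNoise W T N n ω r|) ^ k) :
    MemLp X 2 P ∧ ∫ ω, ‖X ω‖ ^ 2 ∂P ≤ K ^ 2 * noiseMoment D (2 * k) * ((T : ℝ) / N) ^ k := by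
  obtain ⟨hint, hle⟩ := hW.integral_size_pow_le hh (gridTime_succ_sub T N n) k
  have hdom : ∀ᵐ ω ∂P, ‖X ω‖ ^ 2 ≤
      K ^ 2 * (√((T : ℝ) / N) + ∑ r, |stepNoise W T N n ω r|) ^ (2 * k) := by
    filter_upwards [hX] with ω hω
    calc ‖X ω‖ ^ 2 ≤ (K * (√((T : ℝ) / N) + ∑ r, |stepNoise W T N n ω r|) ^ k) ^ 2 :=
          pow_le_pow_left₀ (norm_nonneg _) hω 2
      _ = _ := by rw [mul_pow, ← pow_mul, mul_comm k]
  have hint2 := hint.const_mul (K ^ 2)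
  constructor
  · rw [memLp_two_iff_integrable_sq_norm hXm]
    refine hint2.mono' (hXm.norm.pow 2) ?_
    filter_upwards [hdom] with ω hω
    rwa [Real.norm_eq_abs, abs_of_nonneg (by positivity)]
  · calc _ ≤ ∫ ω, K ^ 2 * (√((T : ℝ) / N) + ∑ r, |stepNoise W T N n ω r|) ^ (2 * k) ∂P :=
          integral_mono_of_nonneg (.of_forall fun ω ↦ by positivity) hint2 hdom
      _ ≤ K ^ 2 * (((T : ℝ) / N) ^ k * noiseMoment D (2 * k)) := by
          rw [integral_const_mul]
          gcongr
          exact hle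
      _ = _ := by ring

section MeanSquare

variable {y : ℕ → Ω → EuclideanSpace ℝ (Fin m)} {α₀ : ℕ → Ω → EuclideanSpace ℝ (Fin ν)}
  {α : ℕ → Fin D → Ω → EuclideanSpace ℝ (Fin ν)}

/-- For even `q` the leading terms of the local errors are odd in the noise, and hence orthogonal
to the past. -/
lemma IsDiscretization.integral_inner_leadTerm_eq_zero [IsProbabilityMeasure P]
    (hd : IsDiscretization 𝓕 P W b c f g L Y₀ T N y α₀ α) (hW : IsBrownianFamily 𝓕 W P)
    (hq : Even q) (hL : ContDiff ℝ (q + 1) L) (hg : ∀ r, Continuous (g r)) {n : ℕ} (hn : n < N) :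
    ∫ ω, inner ℝ (∑ k ∈ Finset.range n, leadTerm b c g L q (y k ω) (stepNoise W T N k ω))
      (leadTerm b c g L q (y n ω) (stepNoise W T N n ω)) ∂P = 0 := by
  have hlead := (continuous_leadTerm (b := b) (c := c) hL hg).measurable
  have hpast : Measurable[𝓕 (gridTime T N n)] fun ω ↦
      ∑ k ∈ Finset.range n, leadTerm b c g L q (y k ω) (stepNoise W T N k ω) := by
    refine Finset.measurable_sum _ fun k hk ↦ ?_
    have hk' : k + 1 ≤ n := Finset.mem_range.1 hk
    have h1 := (hd.measurable_y k (by omega)).mono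
      (𝓕.mono (gridTime_mono T N (by omega : k ≤ n))) le_rfl
    have h2 := (hW.measurable_stepNoise T N k).mono (𝓕.mono (gridTime_mono T N hk')) le_rfl
    have := hlead.comp (h1.prodMk h2)
    exact this
  -- the cross term is an odd function of the increments with parameters known at time `t_n`
  have htr : Measurable fun p : (EuclideanSpace ℝ (Fin ν) × EuclideanSpace ℝ (Fin m)) ×
      (Fin D → ℝ) ↦ (p.1.2, fun r ↦ truncIncr ((T : ℝ) / N) (p.2 r)) := by
    have := continuous_truncIncr ((T : ℝ) / N)
    have h : Continuous fun p : (EuclideanSpace ℝ (Fin ν) × EuclideanSpace ℝ (Fin m)) ×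
      (Fin D → ℝ) ↦ (p.1.2, fun r ↦ truncIncr ((T : ℝ) / N) (p.2 r)) := by fun_prop
    exact h.measurable
  have hψ : Measurable fun p : (EuclideanSpace ℝ (Fin ν) × EuclideanSpace ℝ (Fin m)) ×
      (Fin D → ℝ) ↦ (inner ℝ p.1.1
        (leadTerm b c g L q p.1.2 fun r ↦ truncIncr ((T : ℝ) / N) (p.2 r)) : ℝ) := by
    have h1 := hlead.comp htr
    have h2 : Measurable fun p : (EuclideanSpace ℝ (Fin ν) × EuclideanSpace ℝ (Fin m)) ×
      (Fin D → ℝ) ↦ p.1.1 := measurable_fst.fst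
    exact h2.inner h1
  refine hW.integral_eq_zero_of_odd (gridTime_mono T N n.le_succ)
    (hpast.prodMk (hd.measurable_y n hn.le)) hψ fun z u ↦ ?_
  have h : (fun r ↦ truncIncr ((T : ℝ) / N) ((-u) r)) =
      -fun r ↦ truncIncr ((T : ℝ) / N) (u r) := by
    ext r
    simp [truncIncr_neg]
  simp only [h, leadTerm_neg_of_even hq, inner_neg_right]

/-- The global error in mean square, in terms of the bounds `a` and `d` for the leading terms and
the remainders of the local errors: over `N` steps the remainders accumulate with the factor `N ^ 2`
and the leading terms with the factor `N ^ 2` in general, but only `N` for even `q`. -/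
lemma IsDiscretization.integral_norm_sq_le [IsProbabilityMeasure P]
    (hd : IsDiscretization 𝓕 P W b c f g L Y₀ T N y α₀ α) (hW : IsBrownianFamily 𝓕 W P)
    (hL : ContDiff ℝ (q + 1) L) (hg : ∀ r, Continuous (g r)) (hh : 0 < (T : ℝ) / N)
    {K K' : ℝ}
    (hlead : ∀ y w, ‖leadTerm b c g L q y w‖ ≤ K * (√((T : ℝ) / N) + ∑ r, |w r|) ^ (q + 1))
    (hrem : ∀ n < N, ∀ᵐ ω ∂P,
      ‖L (y (n + 1) ω) - L (y n ω) - leadTerm b c g L q (y n ω) (stepNoise W T N n ω)‖ ≤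
        K' * (√((T : ℝ) / N) + ∑ r, |stepNoise W T N n ω r|) ^ (q + 2)) :
    MemLp (fun ω ↦ L (y N ω) - L (y 0 ω)) 2 P ∧
      ∫ ω, ‖L (y N ω) - L (y 0 ω)‖ ^ 2 ∂P ≤
        2 * ((if Even q then (N : ℝ) else (N : ℝ) ^ 2) *
          (K ^ 2 * noiseMoment D (2 * (q + 1)) * ((T : ℝ) / N) ^ (q + 1))) +
        2 * ((N : ℝ) ^ 2 *
          (K' ^ 2 * noiseMoment D (2 * (q + 2)) * ((T : ℝ) / N) ^ (q + 2))) := by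
  have hym (n : ℕ) (hn : n ≤ N) : Measurable (y n) := (hd.measurable_y n hn).mono (𝓕.le _) le_rfl
  have hwm (n : ℕ) : Measurable (stepNoise W T N n) :=
    (hW.measurable_stepNoise T N n).mono (𝓕.le _) le_rfl
  have hLm : Measurable L := hL.continuous.measurable
  set X : ℕ → Ω → EuclideanSpace ℝ (Fin ν) := fun n ω ↦
    leadTerm b c g L q (y n ω) (stepNoise W T N n ω) with hX
  set R : ℕ → Ω → EuclideanSpace ℝ (Fin ν) := fun n ω ↦
    L (y (n + 1) ω) - L (y n ω) - X n ω with hR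
  have hXm (n : ℕ) (hn : n < N) : Measurable (X n) := by
    have := (continuous_leadTerm (b := b) (c := c) hL hg).measurable.comp
      ((hym n hn.le).prodMk (hwm n))
    exact this
  have hRm (n : ℕ) (hn : n < N) : Measurable (R n) :=
    ((hLm.comp (hym (n + 1) hn)).sub (hLm.comp (hym n hn.le))).sub (hXm n hn)
  have hX2 (n : ℕ) (hn : n < N) := hW.integral_norm_sq_le hh
    (hXm n hn).aestronglyMeasurable (.of_forall fun ω ↦ hlead (y n ω) (stepNoise W T N n ω))
  have hR2 (n : ℕ) (hn : n < N) := hW.integral_norm_sq_le hh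
    (hRm n hn).aestronglyMeasurable (hrem n hn)
  have hsum : (fun ω ↦ L (y N ω) - L (y 0 ω)) = fun ω ↦
      ∑ n ∈ Finset.range N, X n ω + ∑ n ∈ Finset.range N, R n ω := by
    ext1 ω
    rw [← Finset.sum_add_distrib, ← Finset.sum_range_sub (fun n ↦ L (y n ω))]
    exact Finset.sum_congr rfl fun n _ ↦ by simp only [hR]; abel
  have hXs : MemLp (fun ω ↦ ∑ n ∈ Finset.range N, X n ω) 2 P :=
    memLp_finsetSum _ fun n hn ↦ (hX2 n (Finset.mem_range.1 hn)).1
  have hRs : MemLp (fun ω ↦ ∑ n ∈ Finset.range N, R n ω) 2 P :=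
    memLp_finsetSum _ fun n hn ↦ (hR2 n (Finset.mem_range.1 hn)).1
  refine ⟨hsum ▸ hXs.add hRs, ?_⟩
  have hconv : ∫ ω, ‖L (y N ω) - L (y 0 ω)‖ ^ 2 ∂P =
      ∫ ω, ‖∑ n ∈ Finset.range N, X n ω + ∑ n ∈ Finset.range N, R n ω‖ ^ 2 ∂P :=
    congrArg (fun F : Ω → EuclideanSpace ℝ (Fin ν) ↦ ∫ ω, ‖F ω‖ ^ 2 ∂P) hsum
  rw [hconv]
  refine (integral_norm_add_sq_le hXs hRs).trans (add_le_add ?_ ?_)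
  · refine mul_le_mul_of_nonneg_left ?_ zero_le_two
    split_ifs with hq
    · exact integral_norm_sq_sum_le_of_orthogonal (fun n hn ↦ (hX2 n hn).1)
        (fun n hn ↦ (hX2 n hn).2)
        fun n hn ↦ hd.integral_inner_leadTerm_eq_zero hW hq hL hg hn
    · exact integral_norm_sq_sum_le (fun n hn ↦ (hX2 n hn).1) fun n hn ↦ (hX2 n hn).2
  · exact mul_le_mul_of_nonneg_left (integral_norm_sq_sum_le (fun n hn ↦ (hR2 n hn).1)
      fun n hn ↦ (hR2 n hn).2) zero_le_two

end MeanSquare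

end Grid

lemma sqrt_le_mul_rpow_of_le {a B h : ℝ} (hB : 0 ≤ B) (hh : 0 ≤ h) {k : ℕ}
    (ha : a ≤ B * h ^ k) : √a ≤ √B * h ^ ((k : ℝ) / 2) := by
  refine (Real.sqrt_le_sqrt ha).trans_eq ?_
  rw [Real.sqrt_mul hB, Real.sqrt_eq_rpow (h ^ k), ← Real.rpow_natCast, ← Real.rpow_mul hh]
  congr 2
  ring

end MAVF

theorem mainTheorem4 {Ω : Type*} {mΩ : MeasurableSpace Ω} (P : Measure Ω) [IsProbabilityMeasure P]
    (𝓕 : Filtration ℝ≥0 mΩ) {m ν D M : ℕ}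
    (W : Fin D → ℝ≥0 → Ω → ℝ) (hW : MAVF.IsBrownianFamily 𝓕 W P)
    (Y₀ : Ω → EuclideanSpace ℝ (Fin m)) (hY₀ : Measurable[𝓕 0] Y₀) (hY₀2 : MemLp Y₀ 2 P)
    (T : ℝ≥0) (hT : 0 < T)
    (f : EuclideanSpace ℝ (Fin m) → EuclideanSpace ℝ (Fin m))
    (g : Fin D → EuclideanSpace ℝ (Fin m) → EuclideanSpace ℝ (Fin m))
    (L : EuclideanSpace ℝ (Fin m) → EuclideanSpace ℝ (Fin ν))
    (hL : MAVF.IsInvariant f g L)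
    (b c : Fin M → ℝ) (q : ℕ) (hq : 2 ≤ q) (hbc : MAVF.HasQuadratureOrder b c q)
    (hf : MAVF.CbSmooth (q + 1) f) (hg : ∀ r, MAVF.CbSmooth (q + 1) (g r))
    (hDL : MAVF.CbSmooth (q + 1) (fderiv ℝ L))
    (hinv : ∀ x, IsUnit (MAVF.gram L x))
    (hinvb : MAVF.CbSmooth 1 (fun x ↦ Ring.inverse (MAVF.gram L x))) :
    ∃ h₀ > (0 : ℝ), ∃ K : ℝ, ∀ N : ℕ, 1 ≤ N → (T : ℝ) / N ≤ h₀ →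
      (∃ y α₀ α, MAVF.IsDiscretization 𝓕 P W b c f g L Y₀ T N y α₀ α) ∧
      ∀ y α₀ α, MAVF.IsDiscretization 𝓕 P W b c f g L Y₀ T N y α₀ α →
        MemLp (fun ω ↦ L (y N ω) - L (y 0 ω)) 2 P ∧
        (Even q →
          √(∫ ω, ‖L (y N ω) - L (y 0 ω)‖ ^ 2 ∂P) ≤ K * ((T : ℝ) / N) ^ ((q : ℝ) / 2)) ∧
        (Odd q →
          √(∫ ω, ‖L (y N ω) - L (y 0 ω)‖ ^ 2 ∂P) ≤ K * ((T : ℝ) / N) ^ (((q : ℝ) - 1) / 2)) := by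
  open MAVF in
  obtain ⟨Ci, hCi⟩ := hinvb.2 0 zero_le_one
  simp only [norm_iteratedFDeriv_zero] at hCi
  obtain ⟨C, hB⟩ := exists_stepBounds (by omega) hbc (by omega : 1 ≤ q + 1) hf hg hDL hinv
    ⟨Ci, hCi⟩
  have hC0 : 0 < C := zero_lt_one.trans_le hB.one_le
  -- bounds for the two highest derivatives of `L`, which is `q + 2` times differentiable
  obtain ⟨K₁, hK₁⟩ := hDL.2 q q.le_succ
  obtain ⟨K₂, hK₂⟩ := hDL.2 (q + 1) le_rfl
  simp only [norm_iteratedFDeriv_fderiv] at hK₁ hK₂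
  have hL2 : ContDiff ℝ (q + 1 + 1) L :=
    contDiff_succ_iff_fderiv.2 ⟨hL.1.differentiable one_ne_zero,
      fun h ↦ absurd h (by norm_cast), by exact_mod_cast hDL.1⟩
  have hL1 : ContDiff ℝ (q + 1) L := hL2.of_le le_self_add
  have hgc (r : Fin D) : Continuous (g r) := (hg r).1.continuous
  obtain ⟨K', hK'⟩ := exists_norm_sub_leadTerm_le hB hL hL2 (K := max K₁ K₂)
    (fun x ↦ (hK₁ x).trans (le_max_left _ _)) (fun x ↦ (hK₂ x).trans (le_max_right _ _)) hbc
  set K := |quadConst b c q| * (K₁ * C ^ (q + 1)) with hKdef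
  have hK₁0 : 0 ≤ K₁ := (norm_nonneg _).trans (hK₁ 0)
  obtain ⟨h₀, hh₀, hh₀1, hsmall⟩ := exists_forall_add_sum_truncIncr_le D
    (inv_pos.2 (by positivity : 0 < 82 * C ^ 14))
  set a := K ^ 2 * noiseMoment D (2 * (q + 1)) with ha
  set d := K' ^ 2 * noiseMoment D (2 * (q + 2)) with hd
  have ha0 : 0 ≤ a := mul_nonneg (sq_nonneg _) (noiseMoment_nonneg _ _)
  have hd0 : 0 ≤ d := mul_nonneg (sq_nonneg _) (noiseMoment_nonneg _ _)
  have hT0 : (0 : ℝ) < T := hT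
  set B := 2 * T * a + 2 * T ^ 2 * a + 2 * T ^ 2 * d with hBdef
  have hB0 : 0 ≤ B := by positivity
  refine ⟨h₀, hh₀, √B, fun N hN hle ↦ ?_⟩
  have hN0 : (0 : ℝ) < N := by exact_mod_cast hN
  have hh : (0 : ℝ) < T / N := by positivity
  have hNh : (N : ℝ) * (T / N) = T := by field_simp
  refine ⟨exists_isDiscretization hB hf.1.continuous hgc hDL.1.continuous hW hY₀
    fun u ↦ hsmall _ hh.le hle u, fun y α₀ α hdisc ↦ ?_⟩
  have hrem (n : ℕ) (hn : n < N) : ∀ᵐ ω ∂P,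
      ‖L (y (n + 1) ω) - L (y n ω) - leadTerm b c g L q (y n ω) (stepNoise W T N n ω)‖ ≤
        K' * (√((T : ℝ) / N) + ∑ r, |stepNoise W T N n ω r|) ^ (q + 2) := by
    filter_upwards [hdisc.step n hn] with ω hω
    exact hK' _ _ _ _ _ _ hh.le (hle.trans hh₀1) (hsmall _ hh.le hle _) hω
  have hlead (z : EuclideanSpace ℝ (Fin m)) (w : Fin D → ℝ) :
      ‖leadTerm b c g L q z w‖ ≤ K * (√((T : ℝ) / N) + ∑ r, |w r|) ^ (q + 1) := by
    refine (norm_leadTerm_le hB hK₁ z w).trans ?_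
    gcongr
    exact le_add_of_nonneg_left (Real.sqrt_nonneg _)
  obtain ⟨hmem, hint⟩ := hdisc.integral_norm_sq_le hW hL1 hgc hh hlead hrem
  set h : ℝ := T / N with hhdef
  have hh1 : h ≤ 1 := hle.trans hh₀1
  refine ⟨hmem, fun hqe ↦ ?_, fun hqo ↦ ?_⟩
  · refine sqrt_le_mul_rpow_of_le hB0 hh.le (hint.trans ?_)
    rw [if_pos hqe]
    calc _ = 2 * (N * h) * a * h ^ q + 2 * (N * h) ^ 2 * d * h ^ q := by ring
      _ = (2 * T * a + 2 * T ^ 2 * d) * h ^ q := by rw [hNh]; ring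
      _ ≤ B * h ^ q := by
          gcongr
          linarith [show 0 ≤ 2 * (T : ℝ) ^ 2 * a by positivity]
  · obtain ⟨k, rfl⟩ : ∃ k, q = k + 1 := ⟨q - 1, by omega⟩
    have hcast : (((k + 1 : ℕ) : ℝ) - 1) / 2 = (k : ℝ) / 2 := by push_cast; ring
    rw [hcast]
    refine sqrt_le_mul_rpow_of_le hB0 hh.le (hint.trans ?_)
    rw [if_neg (Nat.not_even_iff_odd.2 hqo)]
    calc _ = 2 * (N * h) ^ 2 * a * h ^ k + 2 * (N * h) ^ 2 * d * (h ^ k * h) := by ring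
      _ = 2 * T ^ 2 * a * h ^ k + 2 * T ^ 2 * d * (h ^ k * h) := by rw [hNh]
      _ ≤ 2 * T ^ 2 * a * h ^ k + 2 * T ^ 2 * d * (h ^ k * 1) := by gcongr
      _ = (2 * T ^ 2 * a + 2 * T ^ 2 * d) * h ^ k := by ring
      _ ≤ B * h ^ k := by
          gcongr
          linarith [show 0 ≤ 2 * (T : ℝ) * a by positivity]
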